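/- Let $G$ be a locally compact group with left Haar measure $\eta$. Banach spaces are complex, and an isometric representation $\pi$ of $G$ on a Banach space $E$ is a strongly continuous homomorphism from $G$ to the group of surjective linear isometries of $E$. Put $E^\pi=\{v\in E:\pi_gv=v\ \forall g\in G\}$ and $E_\pi=\{v\in E:\varphi(v)=0$ for every $\varphi\in E^*$ with $\varphi\circ\pi_{g^{-1}}=\varphi$ for all $g\in G\}$. A family $\mathcal F$ of isometric representations has a spectral gap if there are a compact $Q\subseteq G$ and $\kappa>0$ such that $\sup_{s\in Q}\|v-\pi_sv\|\ge\kappa\|v\|$ for every $\pi\in\mathcal F$ (on a space $E$) and every $v\in E_\pi$. For $f\in C_c(G)$ let $\pi(f)v=\int_G f(g)\,\pi_gv\,d\eta(g)$ and $\|f\|_{\mathcal F}=\sup_{\pi\in\mathcal F}\|\pi(f)\|$; let $C_{\mathcal F}(G)$ be the Banach algebra obtained by (Hausdorff) completion of the convolution algebra $C_c(G)$ in the seminorm $\|\cdot\|_{\mathcal F}$, to which every $\pi\in\mathcal F$ extends by continuity. A Kazhdan projection in $C_{\mathcal F}(G)$ is a central idempotent $p$ such that, for every $\pi\in\mathcal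 F$, $\pi(p)$ is the projection of $E$ onto $E^\pi$ along $E_\pi$ (in particular $E=E^\pi\oplus E_\pi$). (1) Let $\mathcal F$ be a family of isometric representations of $G$ on a uniformly convex family of Banach spaces (that is, the infimum over the family of the moduli of convexity is positive at every $t>0$), and assume that $\mathcal F$ contains the trivial representation on some nonzero space. Then $C_{\mathcal F}(G)$ contains a Kazhdan projection if and only if $\mathcal F$ has a spectral gap. Moreover, every Kazhdan projection $p\in C_{\mathcal F}(G)$ is a norm limit of convolution powers: there is $\rho\in C_c(G)$ with $\rho\ge0$ and $\int_G\rho\,d\eta=1$ such that $\rho^{*k}\to p$ in $C_{\mathcal F}(G)$ as $k\to\infty$. (2) Let $E$ be a uniformly convex Banach space and let $\mathcal F$ be the family of all isometric representations of $G$ on $E$. Then $C_{\mathcal F}(G)$ contains a Kazhdan projection if and only if $G$ has uniform property $(TE)$, i.e. $\mathcal F$ has a spectral gap; and every Kazhdan projection in $C_{\mathcal F}(G)$ is a limit of convolution powers of a probability density as in (1). (3) If $G$ has Kazhdan's property (T), then for every $1<p<\infty$ the $L_p$-maximal group algebra $C^p_{\max}(G)$, i.e. $C_{\mathcal F}(G)$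 for the family $\mathcal F$ of all isometric representations of $G$ on $L_p$-spaces, contains a Kazhdan projection, and it is a limit of convolution powers of a probability density as in (1). -/

import Mathlib

open MeasureTheory Filter Topology UniformSpace
open scoped ENNReal CompactlySupported

universe u v w

set_option linter.unusedSectionVars false
set_option linter.checkUnivs false

noncomputable section

/-! ### Isometric representations -/

/-- A strongly continuous representation of the topological group `G` on the complex normed space
`E` by linear surjective isometries. -/
structure IsometricRep (G : Type u) [Group G] [TopologicalSpace G]
    (E : Type v) [NormedAddCommGroup E] [NormedSpace ℂ E] where
  /-- The underlying homomorphism to the group of linear isometries. -/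
  toHom : G →* (E ≃ₗᵢ[ℂ] E)
  /-- Strong continuity: all orbit maps are continuous. -/
  continuous_orbit : ∀ v : E, Continuous fun g : G => toHom g v

namespace IsometricRep

section Basic

variable {G : Type u} [Group G] [TopologicalSpace G]
  {E : Type v} [NormedAddCommGroup E] [NormedSpace ℂ E]

instance : CoeFun (IsometricRep G E) fun _ => G → (E ≃ₗᵢ[ℂ] E) where
  coe π := π.toHom

/-- The representation is trivial: every group element acts as the identity. -/
def IsTrivial (π : IsometricRep G E) : Prop := ∀ (g : G) (v : E), π g v = v

/-- `E^π`: the subspace of vectors fixed by the representation. -/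
def fixed (π : IsometricRep G E) : Submodule ℂ E where
  carrier := {v | ∀ g : G, π g v = v}
  add_mem' := fun {a b} ha hb g => by rw [map_add, ha g, hb g]
  zero_mem' := fun g => map_zero _
  smul_mem' := fun c x hx g => by rw [map_smul, hx g]

/-- The contragredient action on the dual: `π̄_g φ = φ ∘ π_{g⁻¹}`. -/
def contragredient (π : IsometricRep G E) (g : G) (φ : E →L[ℂ] ℂ) : E →L[ℂ] ℂ :=
  φ.comp ((π g⁻¹).toContinuousLinearEquiv : E →L[ℂ] E)

/-- `E_π`: the annihilator in `E` of the functionals fixed by the contragredient action. -/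
def compl (π : IsometricRep G E) : Submodule ℂ E where
  carrier := {v | ∀ φ : E →L[ℂ] ℂ, (∀ g : G, π.contragredient g φ = φ) → φ v = 0}
  add_mem' := fun {a b} ha hb φ hφ => by rw [map_add, ha φ hφ, hb φ hφ, add_zero]
  zero_mem' := fun φ _ => map_zero φ
  smul_mem' := fun c x hx φ hφ => by rw [map_smul, hx φ hφ, smul_zero]

/-- `(Q, κ)` is a Kazhdan pair for `π`: every `v ∈ E_π` satisfies
`sup_{s ∈ Q} ‖v - π_s v‖ ≥ κ ‖v‖`. The supremum is bounded by `2 ‖v‖`. -/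
def IsKazhdanPair (π : IsometricRep G E) (Q : Set G) (κ : ℝ) : Prop :=
  ∀ v ∈ π.compl, κ * ‖v‖ ≤ ⨆ s : Q, ‖v - π s v‖

/-- `T` is the bounded projection `𝒫_π` onto `E^π` along `E_π`; in particular
`E = E^π ⊕ E_π`. -/
def IsFixedProjection (π : IsometricRep G E) (T : E →L[ℂ] E) : Prop :=
  IsIdempotentElem T ∧ T.range = π.fixed ∧ T.ker = π.compl

end Basic

section Integration

variable {G : Type u} [Group G] [TopologicalSpace G] [MeasurableSpace G] [BorelSpace G]
  {E : Type v} [NormedAddCommGroup E] [NormedSpace ℂ E]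

lemma continuous_smul_orbit (π : IsometricRep G E) (f : C_c(G, ℂ)) (v : E) :
    Continuous fun g => f g • π g v :=
  f.continuous.smul (π.continuous_orbit v)

lemma hasCompactSupport_smul_orbit (π : IsometricRep G E) (f : C_c(G, ℂ)) (v : E) :
    HasCompactSupport fun g => f g • π g v :=
  HasCompactSupport.smul_right (f' := fun g => π g v) f.hasCompactSupport

lemma integrable_smul_orbit (π : IsometricRep G E) (η : Measure G) [IsFiniteMeasureOnCompacts η]
    (f : C_c(G, ℂ)) (v : E) : Integrable (fun g => f g • π g v) η :=
  (π.continuous_smul_orbit f v).integrable_of_hasCompactSupport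
    (π.hasCompactSupport_smul_orbit f v)

lemma norm_integral_smul_orbit_le (π : IsometricRep G E) (η : Measure G) (f : C_c(G, ℂ)) (v : E) :
    ‖∫ g, f g • π g v ∂η‖ ≤ (∫ g, ‖f g‖ ∂η) * ‖v‖ := by
  refine (norm_integral_le_integral_norm _).trans (le_of_eq ?_)
  rw [← integral_mul_const]
  simp [norm_smul]

/-- The integrated form `π(f) v = ∫ f(g) π_g v dη(g)` (a Bochner integral), a bounded operator. -/
def integ (π : IsometricRep G E) (η : Measure G) [IsFiniteMeasureOnCompacts η] (f : C_c(G, ℂ)) :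
    E →L[ℂ] E :=
  LinearMap.mkContinuous
    { toFun := fun v => ∫ g, f g • π g v ∂η
      map_add' := fun v w => by
        simp only [map_add, smul_add]
        exact integral_add (π.integrable_smul_orbit η f v) (π.integrable_smul_orbit η f w)
      map_smul' := fun c v => by
        simp only [map_smul, RingHom.id_apply]
        rw [← integral_smul]
        simp only [smul_comm c] }
    (∫ g, ‖f g‖ ∂η) (π.norm_integral_smul_orbit_le η f)

variable (π : IsometricRep G E) (η : Measure G) [IsFiniteMeasureOnCompacts η]

lemma integ_apply (f : C_c(G, ℂ)) (v : E) : π.integ η f v = ∫ g, f g • π g v ∂η := rfl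

lemma norm_integ_le (f : C_c(G, ℂ)) : ‖π.integ η f‖ ≤ ∫ g, ‖f g‖ ∂η :=
  LinearMap.mkContinuous_norm_le _ (integral_nonneg fun _ => norm_nonneg _) _

lemma integ_add (f h : C_c(G, ℂ)) : π.integ η (f + h) = π.integ η f + π.integ η h := by
  ext v
  simp only [integ_apply, add_apply, CompactlySupportedContinuousMap.coe_add,
    Pi.add_apply, add_smul]
  exact integral_add (π.integrable_smul_orbit η f v) (π.integrable_smul_orbit η h v)

lemma integ_smul (c : ℂ) (f : C_c(G, ℂ)) : π.integ η (c • f) = c • π.integ η f := by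
  ext v
  simp only [integ_apply, smul_apply, CompactlySupportedContinuousMap.coe_smul,
    Pi.smul_apply, smul_assoc]
  exact integral_smul c _

end Integration

end IsometricRep

/-! ### Convolution of compactly supported functions -/

section Convolution

variable {G : Type u} [Group G] [TopologicalSpace G] [IsTopologicalGroup G]
  [LocallyCompactSpace G] [MeasurableSpace G] [BorelSpace G]

lemma convolution_continuous (η : Measure G) [IsFiniteMeasureOnCompacts η] (f h : C_c(G, ℂ)) :
    Continuous fun x => ∫ y, f y * h (y⁻¹ * x) ∂η := by
  rw [← continuousOn_univ]
  refine continuousOn_integral_of_compact_support (k := tsupport f) f.hasCompactSupport ?_ ?_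
  · exact ((f.continuous.comp continuous_snd).mul
      (h.continuous.comp (continuous_snd.inv.mul continuous_fst))).continuousOn
  · intro p x _ hx
    rw [image_eq_zero_of_notMem_tsupport hx, zero_mul]

lemma convolution_hasCompactSupport (η : Measure G) (f h : C_c(G, ℂ)) :
    HasCompactSupport fun x => ∫ y, f y * h (y⁻¹ * x) ∂η := by
  refine HasCompactSupport.intro
    ((IsCompact.mul f.hasCompactSupport h.hasCompactSupport)) (fun x hx => ?_)
  refine integral_eq_zero_of_ae (ae_of_all _ fun y => ?_)
  by_contra hne
  refine hx ⟨y, subset_tsupport _ (left_ne_zero_of_mul hne), y⁻¹ * x,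
    subset_tsupport _ (right_ne_zero_of_mul hne), by simp⟩

/-- Convolution on `C_c(G)`: `(f * h)(x) = ∫ f(y) h(y⁻¹ x) dη(y)`. -/
def ccConv (η : Measure G) [IsFiniteMeasureOnCompacts η] (f h : C_c(G, ℂ)) : C_c(G, ℂ) where
  toFun := fun x => ∫ y, f y * h (y⁻¹ * x) ∂η
  continuous_toFun := convolution_continuous η f h
  hasCompactSupport' := convolution_hasCompactSupport η f h

/-- Convolution powers: `ccConvPow η f k` is the `(k + 1)`-fold convolution `f * ⋯ * f`. -/
def ccConvPow (η : Measure G) [IsFiniteMeasureOnCompacts η] (f : C_c(G, ℂ)) : ℕ → C_c(G, ℂ)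
  | 0 => f
  | k + 1 => ccConv η f (ccConvPow η f k)

/-- `f` is the density with respect to `η` of a (compactly supported) probability measure. -/
def IsProbDensity (η : Measure G) (f : C_c(G, ℂ)) : Prop :=
  (∀ g, 0 ≤ (f g).re ∧ (f g).im = 0) ∧ ∫ g, f g ∂η = 1

lemma IsometricRep.integ_conv {E : Type v} [NormedAddCommGroup E] [NormedSpace ℂ E]
    [CompleteSpace E] (π : IsometricRep G E) (η : Measure G) [η.IsHaarMeasure] (f h : C_c(G, ℂ)) :
    π.integ η (ccConv η f h) = π.integ η f * π.integ η h := by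
  ext v
  have hmul : ∀ (x y : G) (u : E), π x (π y u) = π (x * y) u := fun x y u => by
    rw [map_mul]; rfl
  have h1 : ∀ y : G, f y • π y (∫ x, h x • π x v ∂η)
      = ∫ x, f y • h (y⁻¹ * x) • π x v ∂η := by
    intro y
    rw [integral_smul]
    congr 1
    rw [← integral_mul_left_eq_self (fun x => h (y⁻¹ * x) • π x v) y]
    have := ((π y).toContinuousLinearEquiv : E →L[ℂ] E).integral_comp_comm
      (π.integrable_smul_orbit η h v)
    refine this.symm.trans (integral_congr_ae (ae_of_all _ fun x => ?_))
    change π y (h x • π x v) = h (y⁻¹ * (y * x)) • π (y * x) v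
    rw [map_smul, hmul, inv_mul_cancel_left]
  calc π.integ η (ccConv η f h) v
      = ∫ x, ∫ y, f y • h (y⁻¹ * x) • π x v ∂η ∂η := by
        rw [IsometricRep.integ_apply]
        refine integral_congr_ae (ae_of_all _ fun x => ?_)
        simp only [← smul_assoc, smul_eq_mul]
        exact (integral_smul_const _ _).symm
    _ = ∫ y, ∫ x, f y • h (y⁻¹ * x) • π x v ∂η ∂η := by
        refine integral_integral_swap_of_hasCompactSupport ?_ ?_
        · exact (f.continuous.comp continuous_snd).smul
            ((h.continuous.comp (continuous_snd.inv.mul continuous_fst)).smul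
              ((π.continuous_orbit v).comp continuous_fst))
        · refine HasCompactSupport.intro
            ((IsCompact.mul f.hasCompactSupport h.hasCompactSupport).prod f.hasCompactSupport) ?_
          rintro ⟨x, y⟩ hxy
          by_contra hne
          have hf : f y ≠ 0 := fun h0 => hne (by simp [Function.uncurry, h0])
          have hh : h (y⁻¹ * x) ≠ 0 := fun h0 => hne (by simp [Function.uncurry, h0])
          exact hxy ⟨⟨y, subset_tsupport _ hf, y⁻¹ * x, subset_tsupport _ hh, by simp⟩,
            subset_tsupport _ hf⟩
    _ = π.integ η f (π.integ η h v) := by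
        rw [IsometricRep.integ_apply, IsometricRep.integ_apply]
        exact integral_congr_ae (ae_of_all _ fun y => (h1 y).symm)

lemma ccConv_apply (η : Measure G) [IsFiniteMeasureOnCompacts η] (f h : C_c(G, ℂ)) (x : G) :
    ccConv η f h x = ∫ y, f y * h (y⁻¹ * x) ∂η := rfl

lemma integrable_ccConv (η : Measure G) [IsFiniteMeasureOnCompacts η] (f h : C_c(G, ℂ)) (x : G) :
    Integrable (fun y => f y * h (y⁻¹ * x)) η :=
  (f.continuous.mul (h.continuous.comp
    (continuous_inv.mul continuous_const))).integrable_of_hasCompactSupport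
      (HasCompactSupport.mul_right f.hasCompactSupport)

lemma add_ccConv (η : Measure G) [IsFiniteMeasureOnCompacts η] (f f' h : C_c(G, ℂ)) :
    ccConv η (f + f') h = ccConv η f h + ccConv η f' h := by
  ext x
  simp only [ccConv_apply, CompactlySupportedContinuousMap.coe_add, Pi.add_apply, add_mul]
  exact integral_add (integrable_ccConv η f h x) (integrable_ccConv η f' h x)

lemma ccConv_add (η : Measure G) [IsFiniteMeasureOnCompacts η] (f h h' : C_c(G, ℂ)) :
    ccConv η f (h + h') = ccConv η f h + ccConv η f h' := by
  ext x
  simp only [ccConv_apply, CompactlySupportedContinuousMap.coe_add, Pi.add_apply, mul_add]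
  exact integral_add (integrable_ccConv η f h x) (integrable_ccConv η f h' x)

lemma ccConv_assoc (η : Measure G) [η.IsHaarMeasure] (f g h : C_c(G, ℂ)) :
    ccConv η (ccConv η f g) h = ccConv η f (ccConv η g h) := by
  ext x
  calc ccConv η (ccConv η f g) h x
      = ∫ z, ∫ y, f y * g (y⁻¹ * z) * h (z⁻¹ * x) ∂η ∂η := by
        rw [ccConv_apply]
        refine integral_congr_ae (ae_of_all _ fun z => ?_)
        exact (integral_mul_const _ _).symm
    _ = ∫ y, ∫ z, f y * g (y⁻¹ * z) * h (z⁻¹ * x) ∂η ∂η := by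
        refine integral_integral_swap_of_hasCompactSupport ?_ ?_
        · exact ((f.continuous.comp continuous_snd).mul
            (g.continuous.comp (continuous_snd.inv.mul continuous_fst))).mul
              (h.continuous.comp (continuous_fst.inv.mul continuous_const))
        · refine HasCompactSupport.intro
            ((IsCompact.mul f.hasCompactSupport g.hasCompactSupport).prod f.hasCompactSupport) ?_
          rintro ⟨z, y⟩ hzy
          by_contra hne
          have hf : f y ≠ 0 := fun h0 => hne (by simp [Function.uncurry, h0])
          have hg : g (y⁻¹ * z) ≠ 0 := fun h0 => hne (by simp [Function.uncurry, h0])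
          exact hzy ⟨⟨y, subset_tsupport _ hf, y⁻¹ * z, subset_tsupport _ hg, by simp⟩,
            subset_tsupport _ hf⟩
    _ = ccConv η f (ccConv η g h) x := by
        rw [ccConv_apply]
        refine integral_congr_ae (ae_of_all _ fun y => ?_)
        simp only [ccConv_apply, mul_assoc]
        rw [integral_const_mul,
          ← integral_mul_left_eq_self (fun z => g (y⁻¹ * z) * h (z⁻¹ * x)) y]
        simp [mul_assoc]

end Convolution

/-! ### Families of isometric representations -/

/-- A family of isometric representations of `G` on complex Banach spaces. -/
structure RepFamily (G : Type u) [Group G] [TopologicalSpace G] where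
  /-- The index set. -/
  ι : Type w
  /-- The spaces. -/
  E : ι → Type v
  [normed : ∀ i, NormedAddCommGroup (E i)]
  [space : ∀ i, NormedSpace ℂ (E i)]
  [complete : ∀ i, CompleteSpace (E i)]
  /-- The representations. -/
  rep : ∀ i, IsometricRep G (E i)

attribute [instance] RepFamily.normed RepFamily.space RepFamily.complete

namespace RepFamily

section Gap

variable {G : Type u} [Group G] [TopologicalSpace G]

/-- The spaces of the family form a uniformly convex family: for every `t > 0` the moduli of
convexity satisfy `inf_i δ_{E i}(t) > 0`. -/
def IsUniformlyConvex (F : RepFamily.{u, v, w} G) : Prop :=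
  ∀ t : ℝ, 0 < t → ∃ δ : ℝ, 0 < δ ∧ ∀ (i : F.ι) (x y : F.E i),
    ‖x‖ = 1 → ‖y‖ = 1 → t ≤ ‖x - y‖ → δ ≤ 1 - ‖(2⁻¹ : ℂ) • (x + y)‖

/-- The family contains the trivial representation on a nonzero space. -/
def HasTrivialRep (F : RepFamily.{u, v, w} G) : Prop :=
  ∃ i, Nontrivial (F.E i) ∧ (F.rep i).IsTrivial

/-- The family has a spectral gap: some pair `(Q, κ)` with `Q` compact and `κ > 0` is a Kazhdan
pair for all members simultaneously. -/
def HasSpectralGap (F : RepFamily.{u, v, w} G) : Prop :=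
  ∃ (Q : Set G) (κ : ℝ), IsCompact Q ∧ 0 < κ ∧ ∀ i, (F.rep i).IsKazhdanPair Q κ

variable (G)

/-- The family of all isometric representations of `G` on a fixed Banach space `E`. -/
def allOn (E : Type v) [NormedAddCommGroup E] [NormedSpace ℂ E] [CompleteSpace E] :
    RepFamily.{u, v, max u v} G where
  ι := IsometricRep G E
  E := fun _ => E
  rep := fun π => π

/-- An isometric representation of `G` on the space `L_p(X, ν)` of some measure space. -/
structure LpRep (p : ℝ≥0∞) [Fact (1 ≤ p)] where
  /-- The measure space. -/
  X : Type v
  [meas : MeasurableSpace X]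
  /-- The measure. -/
  ν : Measure X
  /-- The representation. -/
  rep : IsometricRep G (Lp ℂ p ν)

attribute [instance] LpRep.meas

/-- The family of all isometric representations of `G` on (complex) `L_p`-spaces. -/
def allLp (p : ℝ≥0∞) [Fact (1 ≤ p)] : RepFamily.{u, v, max u (v + 1)} G where
  ι := LpRep.{u, v} G p
  E := fun i => Lp ℂ p i.ν
  rep := fun i => i.rep

end Gap

/-! ### The completed group algebra of a family -/

section Algebra

variable {G : Type u} [Group G] [TopologicalSpace G] [IsTopologicalGroup G]
  [LocallyCompactSpace G] [MeasurableSpace G] [BorelSpace G]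

/-- The vector space `C_c(G)`, to be endowed with convolution and the norm `‖·‖_F`. -/
def Cc (_F : RepFamily.{u, v, w} G) (_η : Measure G) : Type u := C_c(G, ℂ)

namespace Cc

variable (F : RepFamily.{u, v, w} G) (η : Measure G)

instance : AddCommGroup (F.Cc η) := inferInstanceAs (AddCommGroup C_c(G, ℂ))

instance : Module ℂ (F.Cc η) := inferInstanceAs (Module ℂ C_c(G, ℂ))

/-- The function `f`, seen in the group algebra. -/
def of (f : C_c(G, ℂ)) : F.Cc η := f

variable {F η}

/-- The underlying function. -/
def fn (f : F.Cc η) : C_c(G, ℂ) := f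

variable [η.IsHaarMeasure]

instance : Mul (F.Cc η) := ⟨fun f h => of F η (ccConv η f.fn h.fn)⟩

/-- `‖f‖_F = sup_{π ∈ F} ‖π(f)‖`. -/
instance : Norm (F.Cc η) := ⟨fun f => ⨆ i, ‖(F.rep i).integ η f.fn‖⟩

lemma norm_def (f : F.Cc η) : ‖f‖ = ⨆ i, ‖(F.rep i).integ η f.fn‖ := rfl

lemma bddAbove (f : F.Cc η) : BddAbove (Set.range fun i => ‖(F.rep i).integ η f.fn‖) :=
  ⟨_, Set.forall_mem_range.2 fun i => (F.rep i).norm_integ_le η f.fn⟩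

lemma norm_integ_le (f : F.Cc η) (i : F.ι) : ‖(F.rep i).integ η f.fn‖ ≤ ‖f‖ :=
  le_ciSup (bddAbove f) i

lemma norm_nonneg' (f : F.Cc η) : 0 ≤ ‖f‖ := Real.iSup_nonneg fun _ => norm_nonneg _

lemma norm_le (f : F.Cc η) {C : ℝ} (hC : 0 ≤ C) (h : ∀ i, ‖(F.rep i).integ η f.fn‖ ≤ C) :
    ‖f‖ ≤ C := Real.iSup_le h hC

/-- The representation `π_i`, as a linear map on `C_c(G)`. -/
def integₗ (F : RepFamily.{u, v, w} G) (η : Measure G) [η.IsHaarMeasure] (i : F.ι) :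
    F.Cc η →ₗ[ℂ] (F.E i →L[ℂ] F.E i) where
  toFun := fun f => (F.rep i).integ η f.fn
  map_add' := fun f h => (F.rep i).integ_add η f.fn h.fn
  map_smul' := fun c f => (F.rep i).integ_smul η c f.fn

lemma integₗ_mul (i : F.ι) (f h : F.Cc η) :
    integₗ F η i (f * h) = integₗ F η i f * integₗ F η i h :=
  (F.rep i).integ_conv η f.fn h.fn

instance : SeminormedAddCommGroup (F.Cc η) :=
  SeminormedAddCommGroup.ofCore (𝕜 := ℂ)
    { norm_nonneg := norm_nonneg'
      norm_smul := fun c f => by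
        rw [norm_def, norm_def, Real.mul_iSup_of_nonneg (norm_nonneg c)]
        congr 1; ext i
        rw [← norm_smul]
        exact congrArg norm ((integₗ F η i).map_smul c f)
      norm_triangle := fun f h => norm_le _ (add_nonneg (norm_nonneg' f) (norm_nonneg' h))
        fun i => by
          have : (F.rep i).integ η (f + h).fn
            = (F.rep i).integ η f.fn + (F.rep i).integ η h.fn := (integₗ F η i).map_add f h
          rw [this]
          exact (norm_add_le _ _).trans (add_le_add (norm_integ_le f i) (norm_integ_le h i)) }

/-- `C_c(G)` with convolution and the norm `‖·‖_F` is a seminormed algebra. -/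
instance : NonUnitalSeminormedRing (F.Cc η) :=
  { (inferInstance : SeminormedAddCommGroup (F.Cc η)), (inferInstance : Mul (F.Cc η)) with
    left_distrib := fun f h h' => ccConv_add η f.fn h.fn h'.fn
    right_distrib := fun f f' h => add_ccConv η f.fn f'.fn h.fn
    zero_mul := fun f => by
      have := add_ccConv η 0 0 f.fn
      rw [add_zero] at this
      exact left_eq_add.1 this
    mul_zero := fun f => by
      have := ccConv_add η f.fn 0 0
      rw [add_zero] at this
      exact left_eq_add.1 this
    mul_assoc := fun f g h => ccConv_assoc η f.fn g.fn h.fn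
    norm_mul_le := fun f h => norm_le _ (mul_nonneg (norm_nonneg' f) (norm_nonneg' h)) fun i => by
      refine (congrArg norm (integₗ_mul i f h)).le.trans ((_root_.norm_mul_le _ _).trans ?_)
      exact mul_le_mul (norm_integ_le f i) (norm_integ_le h i) (norm_nonneg _) (norm_nonneg' f) }

instance : NormedSpace ℂ (F.Cc η) where
  norm_smul_le := fun c f => by
    rw [norm_def, norm_def, Real.mul_iSup_of_nonneg (norm_nonneg c)]
    refine le_of_eq ?_
    congr 1; ext i
    rw [← norm_smul]
    exact congrArg norm ((integₗ F η i).map_smul c f)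

end Cc

/-- `C_F(G)`: the completion of `C_c(G)` with respect to `‖·‖_F`. -/
def GroupAlg (F : RepFamily.{u, v, w} G) (η : Measure G) [η.IsHaarMeasure] : Type u :=
  Completion (F.Cc η)

namespace GroupAlg

variable (F : RepFamily.{u, v, w} G) (η : Measure G) [η.IsHaarMeasure]

instance : NormedAddCommGroup (F.GroupAlg η) :=
  inferInstanceAs (NormedAddCommGroup (Completion (F.Cc η)))

instance : NormedSpace ℂ (F.GroupAlg η) :=
  inferInstanceAs (NormedSpace ℂ (Completion (F.Cc η)))

instance : CompleteSpace (F.GroupAlg η) :=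
  inferInstanceAs (CompleteSpace (Completion (F.Cc η)))

/-- The canonical map from the seminormed algebra `C_c(G)` to its completion. -/
def mk (a : F.Cc η) : F.GroupAlg η := (a : Completion (F.Cc η))

/-- The canonical map `C_c(G) → C_F(G)`. -/
def of (f : C_c(G, ℂ)) : F.GroupAlg η := mk F η (Cc.of F η f)

/-- The product of `C_F(G)`: the continuous extension of the convolution of `C_c(G)`. -/
instance : Mul (F.GroupAlg η) :=
  ⟨Function.curry <| (Completion.isDenseInducing_coe.prodMap Completion.isDenseInducing_coe).extend
    (fun x : F.Cc η × F.Cc η => ((x.1 * x.2 : F.Cc η) : Completion (F.Cc η)))⟩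

lemma mk_mul (a b : F.Cc η) : mk F η (a * b) = mk F η a * mk F η b :=
  ((Completion.isDenseInducing_coe.prodMap Completion.isDenseInducing_coe).extend_eq
    ((Completion.continuous_coe (F.Cc η)).comp (continuous_mul (M := F.Cc η))) (a, b)).symm

lemma mk_add (a b : F.Cc η) : mk F η (a + b) = mk F η a + mk F η b := Completion.coe_add a b

lemma mk_zero : mk F η 0 = 0 := Completion.coe_zero

lemma norm_mk (a : F.Cc η) : ‖mk F η a‖ = ‖a‖ := Completion.norm_coe a

lemma denseRange_mk : DenseRange (mk F η) := Completion.denseRange_coe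

lemma of_mul (f h : C_c(G, ℂ)) : of F η f * of F η h = of F η (ccConv η f h) :=
  (mk_mul F η (Cc.of F η f) (Cc.of F η h)).symm

instance : ContinuousMul (F.GroupAlg η) where
  continuous_mul := by
    let m := (AddMonoidHom.mul : F.Cc η →+ F.Cc η →+ F.Cc η).compr₂ Completion.toCompl
    have : Continuous fun p : F.Cc η × F.Cc η => m p.1 p.2 :=
      (Completion.continuous_coe (F.Cc η)).comp continuous_mul
    have di : IsDenseInducing (Completion.toCompl : F.Cc η → Completion (F.Cc η)) :=
      Completion.isDenseInducing_coe
    exact (di.extend_Z_bilin di this :)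

/-- `C_F(G)` is a Banach algebra. -/
instance : NonUnitalNormedRing (F.GroupAlg η) :=
  { (inferInstance : NormedAddCommGroup (F.GroupAlg η)), (inferInstance : Mul (F.GroupAlg η)) with
    left_distrib := fun a b c => (denseRange_mk F η).induction_on₃
      (p := fun a b c => a * (b + c) = a * b + a * c)
      (isClosed_eq (by fun_prop) (by fun_prop))
      (fun a b c => by rw [← mk_add, ← mk_mul, ← mk_mul, ← mk_mul, ← mk_add, mul_add]) a b c
    right_distrib := fun a b c => (denseRange_mk F η).induction_on₃
      (p := fun a b c => (a + b) * c = a * c + b * c)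
      (isClosed_eq (by fun_prop) (by fun_prop))
      (fun a b c => by rw [← mk_add, ← mk_mul, ← mk_mul, ← mk_mul, ← mk_add, add_mul]) a b c
    zero_mul := fun a => (denseRange_mk F η).induction_on
      (p := fun a => 0 * a = 0) a (isClosed_eq (by fun_prop) (by fun_prop))
      (fun a => by rw [← mk_zero, ← mk_mul, zero_mul])
    mul_zero := fun a => (denseRange_mk F η).induction_on
      (p := fun a => a * 0 = 0) a (isClosed_eq (by fun_prop) (by fun_prop))
      (fun a => by rw [← mk_zero, ← mk_mul, mul_zero])
    mul_assoc := fun a b c => (denseRange_mk F η).induction_on₃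
      (p := fun a b c => a * b * c = a * (b * c))
      (isClosed_eq (by fun_prop) (by fun_prop))
      (fun a b c => by rw [← mk_mul, ← mk_mul, ← mk_mul, ← mk_mul, mul_assoc]) a b c
    norm_mul_le := fun a b => (denseRange_mk F η).induction_on₂
      (p := fun a b => ‖a * b‖ ≤ ‖a‖ * ‖b‖)
      (isClosed_le (by fun_prop) (by fun_prop))
      (fun a b => by
        rw [← mk_mul, norm_mk, norm_mk, norm_mk]
        exact norm_mul_le a b) a b }

/-- The extension of the integrated form `f ↦ π_i(f)` from `C_c(G)` to `C_F(G)` by continuity. -/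
def rep (i : F.ι) : F.GroupAlg η → (F.E i →L[ℂ] F.E i) :=
  Completion.extension fun a : F.Cc η => (F.rep i).integ η a.fn

lemma uniformContinuous_integ (i : F.ι) :
    UniformContinuous fun a : F.Cc η => (F.rep i).integ η a.fn :=
  (AddMonoidHomClass.lipschitz_of_bound (Cc.integₗ F η i) 1 fun a => by
    rw [one_mul]
    exact Cc.norm_integ_le a i).uniformContinuous

lemma rep_of (i : F.ι) (f : C_c(G, ℂ)) : rep F η i (of F η f) = (F.rep i).integ η f :=
  Completion.extension_coe (uniformContinuous_integ F η i) _

lemma continuous_rep (i : F.ι) : Continuous (rep F η i) :=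
  Completion.continuous_extension

/-- A Kazhdan projection in `C_F(G)`: a central idempotent `p` such that `π(p) = 𝒫_π` is the
projection onto `E^π` along `E_π` for every `π ∈ F`. -/
def IsKazhdanProjection {F : RepFamily.{u, v, w} G} {η : Measure G} [η.IsHaarMeasure]
    (p : F.GroupAlg η) : Prop :=
  IsIdempotentElem p ∧ (∀ x, p * x = x * p) ∧
    ∀ i, (F.rep i).IsFixedProjection (rep F η i p)

/-- `p` is the norm limit in `C_F(G)` of the convolution powers of a compactly supported
continuous probability density. -/
def IsLimitOfConvPowers {F : RepFamily.{u, v, w} G} {η : Measure G} [η.IsHaarMeasure]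
    (p : F.GroupAlg η) : Prop :=
  ∃ ρ : C_c(G, ℂ), IsProbDensity η ρ ∧
    Tendsto (fun k : ℕ => of F η (ccConvPow η ρ k)) atTop (𝓝 p)

end GroupAlg

end Algebra

end RepFamily

/-! ### Rigidity properties of the group -/

section Properties

variable (G : Type u) [Group G] [TopologicalSpace G]

/-- Uniform property `(TE)`: the family of all isometric representations of `G` on `E` has a
spectral gap. -/
def HasUniformTE (E : Type v) [NormedAddCommGroup E] [NormedSpace ℂ E] [CompleteSpace E] : Prop :=
  (RepFamily.allOn G E).HasSpectralGap

/-- Kazhdan's property (T): there are a compact `Q ⊆ G` and `ε > 0` such that every (strongly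
continuous) unitary representation with a nonzero `(Q, ε)`-invariant vector has a nonzero
invariant vector. Hilbert spaces in the universe of `G` suffice, since every vector lies in an
invariant closed subspace that is isometric to one in that universe. -/
def HasPropertyT : Prop :=
  ∃ (Q : Set G) (ε : ℝ), IsCompact Q ∧ 0 < ε ∧
    ∀ (H : Type u) [NormedAddCommGroup H] [InnerProductSpace ℂ H] [CompleteSpace H]
      (π : IsometricRep G H),
      (∃ v : H, v ≠ 0 ∧ ∀ s ∈ Q, ‖π s v - v‖ < ε * ‖v‖) →
        ∃ w : H, w ≠ 0 ∧ ∀ g : G, π g w = w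

end Properties

end

/-!
# Kazhdan projections and spectral gaps

**From a spectral gap to a projection.** Let `(Q, κ)` be a Kazhdan pair. Choose probability densities
`ρ` and `β` in `C_c(G)` with `ρ ≥ c (β + s·β)` for all `s ∈ Q`
(`exists_probDensity_dominating`). For a unit vector `v ∈ E_π` put `w = π(β) v ∈ E_π`; some `s ∈ Q`
moves `w` by at least `κ ‖w‖ / 2`, so by uniform convexity the midpoint of `w` and `π_s w` is
shorter than `v` by a definite factor, and therefore `‖π(ρ) v‖ ≤ r ‖v‖` with `r < 1` uniform over
the family (`IsometricRep.norm_integ_le_of_isKazhdanPair`). Since `π(ρ)` is moreover the identity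
modulo `E_π`, its fixed vectors form a complement of `E_π`. They are exactly the vectors of `E^π`:
this follows from strict convexity, on comparing `π(ρ)` with `(π(ρ) + π_g π(ρ)) / 2`
(`IsometricRep.exists_mem_fixed_sub_mem_compl`). Hence the powers of `π(ρ)` converge to the
projection at a geometric rate, uniformly over the family, and `ρ^{*k}` converges in `C_F(G)`. The
representations of the family jointly determine the norm of `C_F(G)`, which makes the limit a
central idempotent and Kazhdan projections unique.

**From a projection to a spectral gap.** A function `f ∈ C_c(G)` close to a Kazhdan projection has
integral close to `1`, by the trivial representation, and `π(f)` is small on `E_π`. For `v ∈ E_π` the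
integral of `f(g) (v - π_g v)` is then comparable to `v`, so the support of `f` is a Kazhdan set.

**Property (T) and `L_p`.** For `p ≠ 2` isometries of `L_p` preserve disjointness of supports, which
is the case of equality in Clarkson's inequality (`lpDisjoint_iff`). Conjugating by the Mazur map
`f ↦ f |f|^(p/2 - 1)` therefore turns an isometric representation on `L_p` into a unitary
representation on `L_2`: linearity is checked on simple functions (`mazur_conj_add`), without
reference to the Banach–Lamperti theorem or to any finiteness of the measure. In the same way the
isometries preserve the duality map of `L_p` (`dualityMap_map`), so that the functional norming a
fixed vector is invariant, whence unit vectors of `E_π` have distance at least `1 / 2` from `E^π`. An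
almost invariant unit vector of `E_π` would be sent by the Mazur map to an almost invariant vector of
`L_2`, which property (T) puts near a fixed vector, contradicting that distance
(`HasPropertyT.hasSpectralGap_allLp`). Uniform continuity of the Mazur map and uniform convexity of
`L_p`, for all `1 < p < ∞` and uniformly over measure spaces, both come from integrating a pointwise
inequality that holds by compactness and homogeneity (`exists_le_add_mul_of_homogeneous`).
-/

noncomputable section

/-! ### Uniform convexity and the decomposition `E = E^π ⊕ E_π` -/

section Decomposition

variable {E : Type v} [NormedAddCommGroup E] [NormedSpace ℂ E]

/-- The modulus of convexity of `E` at `t` is at least `δ`. -/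
def ConvexityModulusGE (E : Type v) [NormedAddCommGroup E] [NormedSpace ℂ E] (t δ : ℝ) : Prop :=
  ∀ x y : E, ‖x‖ = 1 → ‖y‖ = 1 → t ≤ ‖x - y‖ → δ ≤ 1 - ‖(2⁻¹ : ℂ) • (x + y)‖

lemma ConvexityModulusGE.norm_midpoint_le {t δ : ℝ} (h : ConvexityModulusGE E t δ) {x y : E}
    (hxy : ‖y‖ = ‖x‖) (ht : t * ‖x‖ ≤ ‖x - y‖) :
    ‖(2⁻¹ : ℂ) • (x + y)‖ ≤ (1 - δ) * ‖x‖ := by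
  rcases eq_or_ne x 0 with rfl | hx
  · have : y = 0 := by simpa using hxy
    simp [this]
  have hx' : 0 < ‖x‖ := norm_pos_iff.2 hx
  have hc : ‖((‖x‖⁻¹ : ℝ) : ℂ)‖ = ‖x‖⁻¹ := by simp
  have := h (((‖x‖⁻¹ : ℝ) : ℂ) • x) (((‖x‖⁻¹ : ℝ) : ℂ) • y)
    (by rw [norm_smul, hc, inv_mul_cancel₀ hx'.ne'])
    (by rw [norm_smul, hc, hxy, inv_mul_cancel₀ hx'.ne'])
    (by rw [← smul_sub, norm_smul, hc, inv_mul_eq_div, le_div_iff₀ hx']; exact ht)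
  rw [← smul_add, smul_comm, norm_smul, hc, inv_mul_eq_div, le_sub_comm, div_le_iff₀ hx'] at this
  exact this

/-- A space all of whose moduli of convexity are positive is strictly convex. -/
lemma eq_of_norm_le_norm_midpoint (h : ∀ t : ℝ, 0 < t → ∃ δ, 0 < δ ∧ ConvexityModulusGE E t δ)
    {x y : E} (hxy : ‖y‖ = ‖x‖) (hm : ‖x‖ ≤ ‖(2⁻¹ : ℂ) • (x + y)‖) : x = y := by
  rcases eq_or_ne x 0 with rfl | hx
  · exact (show y = 0 by simpa using hxy).symm
  have hx' : 0 < ‖x‖ := norm_pos_iff.2 hx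
  by_contra hne
  have hd : 0 < ‖x - y‖ := norm_pos_iff.2 (sub_ne_zero.2 hne)
  obtain ⟨δ, hδ, H⟩ := h (‖x - y‖ / ‖x‖) (by positivity)
  have := H.norm_midpoint_le hxy (by rw [div_mul_cancel₀ _ hx'.ne'])
  nlinarith

lemma pow_contraction {W : Submodule ℂ E} {S : E →L[ℂ] E} {r : ℝ} (hr0 : 0 ≤ r)
    (hS : ∀ v, S v - v ∈ W) (hr : ∀ v ∈ W, ‖S v‖ ≤ r * ‖v‖) {v : E} (hv : v ∈ W) (k : ℕ) :
    (S ^ k) v ∈ W ∧ ‖(S ^ k) v‖ ≤ r ^ k * ‖v‖ := by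
  induction k with
  | zero => simpa using hv
  | succ k ih =>
    rw [pow_succ', mul_apply_eq_comp]
    refine ⟨?_, (hr _ ih.1).trans ?_⟩
    · have := W.add_mem (hS ((S ^ k) v)) ih.1
      rwa [sub_add_cancel] at this
    · rw [pow_succ', mul_assoc]
      exact mul_le_mul_of_nonneg_left ih.2 hr0

lemma pow_apply_eq_self {S : E →L[ℂ] E} {x : E} (hx : S x = x) (k : ℕ) : (S ^ k) x = x := by
  induction k with
  | zero => rfl
  | succ k ih => rw [pow_succ, mul_apply_eq_comp, hx, ih]

/-- An operator acting as the identity modulo a closed subspace `W` and as a strict contraction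
on `W` splits the space: its fixed vectors form a complement of `W`. -/
lemma exists_fixedPoint_sub_mem [CompleteSpace E] {W : Submodule ℂ E}
    (hW : IsClosed (W : Set E)) {S : E →L[ℂ] E} {r : ℝ} (hr0 : 0 ≤ r) (hr1 : r < 1)
    (hS : ∀ v, S v - v ∈ W) (hr : ∀ v ∈ W, ‖S v‖ ≤ r * ‖v‖) (v : E) :
    ∃ x, S x = x ∧ v - x ∈ W := by
  have hstep : ∀ k, (S ^ (k + 1)) v - (S ^ k) v = (S ^ k) (S v - v) := fun k => by
    rw [map_sub, pow_succ, mul_apply_eq_comp]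
  have hcau : CauchySeq fun k => (S ^ k) v := by
    refine cauchySeq_of_le_geometric r ‖S v - v‖ hr1 fun k => ?_
    rw [dist_comm, dist_eq_norm, hstep, mul_comm]
    exact (pow_contraction hr0 hS hr (hS v) k).2
  obtain ⟨x, hx⟩ := cauchySeq_tendsto_of_complete hcau
  refine ⟨x, ?_, ?_⟩
  · have h1 : Tendsto (fun k => (S ^ (k + 1)) v) atTop (𝓝 (S x)) := by
      simp only [pow_succ']
      exact (S.continuous.tendsto x).comp hx
    exact tendsto_nhds_unique h1 (hx.comp (tendsto_add_atTop_nat 1))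
  · refine hW.mem_of_tendsto (tendsto_const_nhds.sub hx) (Eventually.of_forall fun k => ?_)
    induction k with
    | zero => simp
    | succ k ih =>
      have := W.sub_mem ih (pow_contraction hr0 hS hr (hS v) k).1
      rw [← hstep] at this
      simpa using this

end Decomposition

namespace IsometricRep

section Complement

variable {G : Type u} [Group G] [TopologicalSpace G]
  {E : Type v} [NormedAddCommGroup E] [NormedSpace ℂ E] (π : IsometricRep G E)

lemma contragredient_eq_iff {φ : E →L[ℂ] ℂ} :
    (∀ g, π.contragredient g φ = φ) ↔ ∀ g v, φ (π g v) = φ v := by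
  constructor
  · intro h g v
    conv_rhs => rw [← h g⁻¹]
    simp [contragredient]
  · intro h g
    ext v
    exact h g⁻¹ v

lemma mem_compl_iff {v : E} :
    v ∈ π.compl ↔ ∀ φ : E →L[ℂ] ℂ, (∀ g v, φ (π g v) = φ v) → φ v = 0 := by
  simp only [← contragredient_eq_iff]
  rfl

lemma mem_fixed_iff {v : E} : v ∈ π.fixed ↔ ∀ g, π g v = v := Iff.rfl

lemma isClosed_compl : IsClosed (π.compl : Set E) := by
  have : (π.compl : Set E) =
      ⋂ φ : {φ : E →L[ℂ] ℂ // ∀ g, π.contragredient g φ = φ}, {v | φ.1 v = 0} := by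
    ext v
    simp only [Set.mem_iInter, Subtype.forall]
    rfl
  rw [this]
  exact isClosed_iInter fun φ => isClosed_eq φ.1.continuous continuous_const

lemma isClosed_fixed : IsClosed (π.fixed : Set E) := by
  have : (π.fixed : Set E) = ⋂ g, {v | π g v = v} := by
    ext v
    simp only [Set.mem_iInter]
    rfl
  rw [this]
  exact isClosed_iInter fun g => isClosed_eq (π g).continuous continuous_id

lemma apply_sub_mem_compl (g : G) (v : E) : π g v - v ∈ π.compl :=
  π.mem_compl_iff.2 fun φ hφ => by rw [map_sub, hφ, sub_self]

/-- If a contraction `T` is the identity modulo `E_π` and a strict contraction on `E_π`, then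
`E = E^π + E_π` for strictly convex `E`. For each `g`, the operator `(T + π_g T) / 2` has the same properties; by strict convexity its fixed vectors are fixed by `T`
and by `π_g`, while the fixed vectors of either operator form a complement of `E_π`. -/
lemma exists_mem_fixed_sub_mem_compl [CompleteSpace E]
    (huc : ∀ t : ℝ, 0 < t → ∃ δ, 0 < δ ∧ ConvexityModulusGE E t δ)
    {T : E →L[ℂ] E} {r : ℝ} (hr0 : 0 ≤ r) (hr1 : r < 1) (hT : ∀ v, T v - v ∈ π.compl)
    (hr : ∀ v ∈ π.compl, ‖T v‖ ≤ r * ‖v‖) (hT1 : ∀ v, ‖T v‖ ≤ ‖v‖) (v : E) :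
    ∃ x ∈ π.fixed, T x = x ∧ v - x ∈ π.compl := by
  obtain ⟨x, hx, hvx⟩ := exists_fixedPoint_sub_mem π.isClosed_compl hr0 hr1 hT hr v
  refine ⟨x, fun g => ?_, hx, hvx⟩
  let U : E →L[ℂ] E := (π g).toContinuousLinearEquiv
  let S : E →L[ℂ] E := (2⁻¹ : ℂ) • (T + U.comp T)
  have hSv : ∀ v, S v = (2⁻¹ : ℂ) • (T v + π g (T v)) := fun v => rfl
  have hS : ∀ v, S v - v ∈ π.compl := fun v => by
    have : S v - v = (2⁻¹ : ℂ) • ((T v - v) + (T v - v) + (π g (T v) - T v)) := by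
      rw [hSv]
      module
    rw [this]
    exact π.compl.smul_mem _ (π.compl.add_mem (π.compl.add_mem (hT v) (hT v))
      (π.apply_sub_mem_compl g _))
  have hSr : ∀ v ∈ π.compl, ‖S v‖ ≤ r * ‖v‖ := fun v hv => by
    have h1 := norm_add_le (T v) (π g (T v))
    rw [LinearIsometryEquiv.norm_map] at h1
    have h2 := hr v hv
    rw [hSv, norm_smul]
    norm_num
    linarith
  obtain ⟨y, hy, hvy⟩ := exists_fixedPoint_sub_mem π.isClosed_compl hr0 hr1 hS hSr v
  have hTy : T y = π g (T y) := by
    refine eq_of_norm_le_norm_midpoint huc (LinearIsometryEquiv.norm_map _ _) ?_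
    rw [← hSv, hy]
    exact hT1 y
  have hTy' : T y = y := by
    rw [hSv, ← hTy, ← two_smul ℂ (T y), smul_smul] at hy
    simpa using hy
  have hxy : x = y := by
    have hmem : x - y ∈ π.compl := by
      have := π.compl.sub_mem hvy hvx
      rwa [sub_sub_sub_cancel_left] at this
    have := hr _ hmem
    rw [map_sub, hx, hTy'] at this
    rw [← sub_eq_zero, ← norm_eq_zero]
    nlinarith [norm_nonneg (x - y)]
  rw [hxy, ← hTy', ← hTy]

end Complement

end IsometricRep

/-! ### Probability densities that contract the complements of the fixed vectors -/

section Density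

variable {G : Type u} [Group G] [TopologicalSpace G] [IsTopologicalGroup G]
  [LocallyCompactSpace G] [MeasurableSpace G] [BorelSpace G]

/-- The left translate `g ↦ f (s⁻¹ g)`. -/
def ccTranslate (s : G) (f : C_c(G, ℂ)) : C_c(G, ℂ) where
  toFun := fun g => f (s⁻¹ * g)
  continuous_toFun := f.continuous.comp (continuous_const.mul continuous_id)
  hasCompactSupport' := f.hasCompactSupport.comp_homeomorph (Homeomorph.mulLeft s⁻¹)

lemma ccTranslate_apply (s g : G) (f : C_c(G, ℂ)) : ccTranslate s f g = f (s⁻¹ * g) := rfl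

/-- A probability density that is bounded below on a given compact set. -/
lemma exists_probDensity_ge (η : Measure G) [η.IsHaarMeasure] {K : Set G} (hK : IsCompact K) :
    ∃ (ρ : C_c(G, ℂ)) (m : ℝ), 0 < m ∧ IsProbDensity η ρ ∧ ∀ g ∈ K, m ≤ (ρ g).re := by
  -- Adjoining `1` to `K` keeps the integral positive when `K` is empty.
  obtain ⟨f, hf1, -, hfc, hf01⟩ := exists_continuous_one_zero_of_isCompact
    (hK.insert 1) isClosed_empty (Set.disjoint_empty _)
  have hf0 : 0 ≤ (f : G → ℝ) := fun g => (hf01 g).1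
  have hpos : 0 < ∫ g, f g ∂η := f.continuous.integral_pos_of_hasCompactSupport_nonneg_nonzero
    hfc hf0 (x := 1) (by rw [hf1 (Set.mem_insert _ _)]; exact one_ne_zero)
  set I := ∫ g, f g ∂η
  let ρ : C_c(G, ℂ) :=
    { toFun := fun g => ((I⁻¹ * f g : ℝ) : ℂ)
      continuous_toFun := by fun_prop
      hasCompactSupport' := by
        refine hfc.mono fun g hg => ?_
        rw [Function.mem_support] at hg ⊢
        rintro h
        simp [h] at hg }
  have hρ : ∀ g, ρ g = ((I⁻¹ * f g : ℝ) : ℂ) := fun g => rfl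
  refine ⟨ρ, I⁻¹, inv_pos.2 hpos, ⟨fun g => ?_, ?_⟩, fun g hg => ?_⟩
  · rw [hρ, Complex.ofReal_re, Complex.ofReal_im]
    exact ⟨mul_nonneg (inv_pos.2 hpos).le (hf0 g), rfl⟩
  · simp only [hρ]
    rw [integral_complex_ofReal, integral_const_mul, inv_mul_cancel₀ hpos.ne', Complex.ofReal_one]
  · rw [hρ, Complex.ofReal_re, hf1 (Set.mem_insert_of_mem _ hg), Pi.one_apply, mul_one]

open scoped Pointwise in
/-- For compact `Q` there are probability densities `ρ` and `β` such that `ρ` dominates, up to a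
constant, `β` and all its translates by elements of `Q`. -/
lemma exists_probDensity_dominating (η : Measure G) [η.IsHaarMeasure] {Q : Set G}
    (hQ : IsCompact Q) :
    ∃ (ρ β : C_c(G, ℂ)) (c : ℝ), 0 < c ∧ IsProbDensity η ρ ∧ IsProbDensity η β ∧
      ∀ s ∈ Q, ∀ g, c * (β g).re + c * (β (s⁻¹ * g)).re ≤ (ρ g).re := by
  obtain ⟨β, -, -, hβ, -⟩ := exists_probDensity_ge η (isCompact_empty (X := G))
  obtain ⟨C, hC⟩ := β.hasCompactSupport.exists_bound_of_continuous β.continuous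
  have hC0 : 0 ≤ C := (norm_nonneg _).trans (hC 1)
  have hβC : ∀ g, (β g).re ≤ C := fun g => (Complex.re_le_norm _).trans (hC g)
  obtain ⟨ρ, m, hm, hρ, hρm⟩ := exists_probDensity_ge η
    ((hQ.mul β.hasCompactSupport).union β.hasCompactSupport)
  refine ⟨ρ, β, m / (2 * (C + 1)), by positivity, hρ, hβ, fun s hs g => ?_⟩
  by_cases hg : g ∈ Q * tsupport β ∪ tsupport β
  · refine le_trans ?_ (hρm g hg)
    have h1 := hβC g
    have h2 := hβC (s⁻¹ * g)
    rw [← mul_add, div_mul_eq_mul_div, div_le_iff₀ (by positivity)]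
    exact mul_le_mul_of_nonneg_left (by linarith) hm.le
  · rw [Set.mem_union, not_or] at hg
    have h1 : β g = 0 := image_eq_zero_of_notMem_tsupport hg.2
    have h2 : β (s⁻¹ * g) = 0 := image_eq_zero_of_notMem_tsupport fun h =>
      hg.1 ⟨s, hs, s⁻¹ * g, h, by simp⟩
    simpa [h1, h2] using (hρ.1 g).1

lemma integral_norm_eq_of_nonneg {X : Type*} [MeasurableSpace X] {ν : Measure X} {f : X → ℂ}
    (hf : ∀ g, 0 ≤ (f g).re ∧ (f g).im = 0) :
    ((∫ g, ‖f g‖ ∂ν : ℝ) : ℂ) = ∫ g, f g ∂ν := by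
  rw [← integral_complex_ofReal]
  refine integral_congr_ae (ae_of_all _ fun g => ?_)
  have h : f g = ((f g).re : ℂ) := Complex.ext rfl (hf g).2
  change ((‖f g‖ : ℝ) : ℂ) = f g
  rw [h, Complex.norm_real, Real.norm_of_nonneg (hf g).1]

end Density

namespace IsometricRep

section Integrated

variable {G : Type u} [Group G] [TopologicalSpace G] [IsTopologicalGroup G]
  [LocallyCompactSpace G] [MeasurableSpace G] [BorelSpace G]
  {E : Type v} [NormedAddCommGroup E] [NormedSpace ℂ E] [CompleteSpace E]
  (π : IsometricRep G E) (η : Measure G) [η.IsHaarMeasure]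

lemma integ_ccTranslate (s : G) (f : C_c(G, ℂ)) (v : E) :
    π.integ η (ccTranslate s f) v = π s (π.integ η f v) := by
  rw [integ_apply, integ_apply,
    ← integral_mul_left_eq_self (fun g => ccTranslate s f g • π g v) s]
  have := ((π s).toContinuousLinearEquiv : E →L[ℂ] E).integral_comp_comm
    (π.integrable_smul_orbit η f v)
  refine Eq.trans (integral_congr_ae (ae_of_all _ fun x => ?_)) this
  change ccTranslate s f (s * x) • π (s * x) v = π s (f x • π x v)
  rw [map_smul, ccTranslate_apply, inv_mul_cancel_left, map_mul]
  rfl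

lemma integ_apply_of_mem_fixed (f : C_c(G, ℂ)) {v : E} (hv : v ∈ π.fixed) :
    π.integ η f v = (∫ g, f g ∂η) • v := by
  rw [integ_apply, ← integral_smul_const]
  exact integral_congr_ae (ae_of_all _ fun g => by simp only [π.mem_fixed_iff.1 hv g])

lemma invariant_integ (f : C_c(G, ℂ)) {φ : E →L[ℂ] ℂ} (hφ : ∀ g v, φ (π g v) = φ v) (v : E) :
    φ (π.integ η f v) = (∫ g, f g ∂η) * φ v := by
  rw [integ_apply, ← φ.integral_comp_comm (π.integrable_smul_orbit η f v), ← integral_mul_const]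
  exact integral_congr_ae (ae_of_all _ fun g => by simp only [map_smul, hφ, smul_eq_mul])

lemma integ_mem_compl (f : C_c(G, ℂ)) {v : E} (hv : v ∈ π.compl) : π.integ η f v ∈ π.compl :=
  π.mem_compl_iff.2 fun φ hφ => by
    rw [π.invariant_integ η f hφ, π.mem_compl_iff.1 hv φ hφ, mul_zero]

variable {η}

lemma integ_sub_mem_compl {ρ : C_c(G, ℂ)} (hρ : IsProbDensity η ρ) (v : E) :
    π.integ η ρ v - v ∈ π.compl :=
  π.mem_compl_iff.2 fun φ hφ => by
    rw [map_sub, π.invariant_integ η ρ hφ, hρ.2, one_mul, sub_self]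

lemma norm_integ_apply_le {ρ : C_c(G, ℂ)} (hρ : IsProbDensity η ρ) (v : E) :
    ‖π.integ η ρ v‖ ≤ ‖v‖ := by
  have h1 : ∫ g, ‖ρ g‖ ∂η = 1 := by
    have := integral_norm_eq_of_nonneg (ν := η) hρ.1
    rw [hρ.2] at this
    exact_mod_cast this
  have := π.norm_integral_smul_orbit_le η ρ v
  rwa [h1, one_mul] at this

/-- If `ρ ≥ c (β + s·β)`, then `π(ρ) v` splits off the two vectors `c w` and `c π_s w`, where
`w = π(β) v`. -/
lemma norm_integ_le_of_dominating {ρ β : C_c(G, ℂ)} {c : ℝ} (hρ : IsProbDensity η ρ)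
    (hβ : IsProbDensity η β) {s : G} (hc : 0 ≤ c)
    (h : ∀ g, c * (β g).re + c * (β (s⁻¹ * g)).re ≤ (ρ g).re) (v : E) :
    0 ≤ 1 - 2 * c ∧ ‖π.integ η ρ v‖ ≤
      2 * c * ‖(2⁻¹ : ℂ) • (π.integ η β v + π s (π.integ η β v))‖ + (1 - 2 * c) * ‖v‖ := by
  set r : C_c(G, ℂ) := ρ + (-c : ℂ) • (β + ccTranslate s β) with hr
  have hrapp : ∀ g, r g = ρ g - c * (β g + β (s⁻¹ * g)) := fun g => by
    change ρ g + (-c : ℂ) * (β g + β (s⁻¹ * g)) = _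
    ring
  have hr0 : ∀ g, 0 ≤ (r g).re ∧ (r g).im = 0 := fun g => by
    rw [hrapp]
    have := h g
    simp [(hρ.1 g).2, (hβ.1 g).2, (hβ.1 (s⁻¹ * g)).2]
    linarith
  have hint : ∫ g, r g ∂η = ((1 - 2 * c : ℝ) : ℂ) := by
    have e : ∫ g, β (s⁻¹ * g) ∂η = 1 := by
      rw [integral_mul_left_eq_self (fun g => β g) s⁻¹, hβ.2]
    have i2 : Integrable (fun g => β (s⁻¹ * g)) η := (ccTranslate s β).integrable
    have i1 : Integrable (fun g => β g) η := β.integrable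
    have i3 : Integrable (fun g => (c : ℂ) * (β g + β (s⁻¹ * g))) η := (i1.add i2).const_mul _
    simp only [hrapp]
    rw [integral_sub ρ.integrable i3, integral_const_mul,
      integral_add i1 i2, e, hβ.2, hρ.2]
    push_cast
    ring
  have hnorm : ∫ g, ‖r g‖ ∂η = 1 - 2 * c := by
    have := integral_norm_eq_of_nonneg (ν := η) hr0
    rw [hint] at this
    exact_mod_cast this
  refine ⟨hnorm ▸ integral_nonneg fun _ => norm_nonneg _, ?_⟩
  have hsplit : π.integ η ρ v = (2 * c : ℂ) • ((2⁻¹ : ℂ) • (π.integ η β v + π s (π.integ η β v)))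
      + π.integ η r v := by
    rw [hr, integ_add, integ_smul, integ_add]
    simp only [add_apply, smul_apply, integ_ccTranslate]
    module
  rw [hsplit]
  refine (norm_add_le _ _).trans (add_le_add ?_ ?_)
  · rw [norm_smul]
    refine le_of_eq ?_
    congr 1
    rw [norm_mul, Complex.norm_real, Real.norm_of_nonneg hc]
    norm_num
  · have := π.norm_integral_smul_orbit_le η r v
    rwa [hnorm] at this

/-- In a representation with Kazhdan pair `(Q, κ)` on a space whose modulus of convexity at `κ / 2`
is at least `δ`, a density that dominates `c (β + s·β)` for all `s ∈ Q` contracts `E_π`. -/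
lemma norm_integ_le_of_isKazhdanPair {ρ β : C_c(G, ℂ)} {c κ δ : ℝ} (hρ : IsProbDensity η ρ)
    (hβ : IsProbDensity η β) {Q : Set G} (hc : 0 ≤ c) (hκ : 0 < κ) (hδ1 : δ ≤ 1)
    (h : ∀ s ∈ Q, ∀ g, c * (β g).re + c * (β (s⁻¹ * g)).re ≤ (ρ g).re)
    (hπ : π.IsKazhdanPair Q κ) (hE : ConvexityModulusGE E (κ / 2) δ) {v : E} (hv : v ∈ π.compl) :
    ‖π.integ η ρ v‖ ≤ (1 - 2 * c * δ) * ‖v‖ := by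
  rcases eq_or_ne v 0 with rfl | hv0
  · simp
  set w := π.integ η β v with hw
  have hwv : ‖w‖ ≤ ‖v‖ := π.norm_integ_apply_le hβ v
  have key : ∃ s ∈ Q, κ / 2 * ‖w‖ ≤ ‖w - π s w‖ := by
    rcases eq_or_ne w 0 with hw0 | hw0
    · have hne : Nonempty Q := by
        by_contra hemp
        rw [not_nonempty_iff] at hemp
        have := hπ v hv
        rw [Real.iSup_of_isEmpty] at this
        exact absurd this (not_le.2 (mul_pos hκ (norm_pos_iff.2 hv0)))
      obtain ⟨s⟩ := hne
      exact ⟨s, s.2, by simp [hw0]⟩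
    · by_contra! hcon
      have := hπ w (π.integ_mem_compl η β hv)
      have h2 : (⨆ s : Q, ‖w - π s w‖) ≤ κ / 2 * ‖w‖ :=
        Real.iSup_le (fun s => (hcon s s.2).le) (by positivity)
      have h3 := mul_pos hκ (norm_pos_iff.2 hw0)
      linarith
  obtain ⟨s, hs, hsw⟩ := key
  obtain ⟨h0, h1⟩ := π.norm_integ_le_of_dominating hρ hβ hc (h s hs) v
  have h2 := hE.norm_midpoint_le (y := π s w) (LinearIsometryEquiv.norm_map _ _) hsw
  have h3 : (1 - δ) * ‖w‖ ≤ (1 - δ) * ‖v‖ := mul_le_mul_of_nonneg_left hwv (by linarith)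
  have h4 := mul_le_mul_of_nonneg_left (h2.trans h3) (show 0 ≤ 2 * c by linarith)
  linarith

end Integrated

end IsometricRep

/-! ### Kazhdan projections and spectral gaps -/

namespace RepFamily

variable {G : Type u} [Group G] [TopologicalSpace G] [IsTopologicalGroup G]
  [LocallyCompactSpace G] [MeasurableSpace G] [BorelSpace G]

section Rep

variable (F : RepFamily.{u, v, w} G) (η : Measure G) [η.IsHaarMeasure]

lemma integ_ccConvPow {E : Type v} [NormedAddCommGroup E] [NormedSpace ℂ E] [CompleteSpace E]
    (π : IsometricRep G E) (ρ : C_c(G, ℂ)) (k : ℕ) :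
    π.integ η (ccConvPow η ρ k) = π.integ η ρ ^ (k + 1) := by
  induction k with
  | zero => rw [zero_add, pow_one]; rfl
  | succ k ih => rw [pow_succ', ← ih, ← π.integ_conv]; rfl

namespace GroupAlg

lemma rep_mk (i : F.ι) (a : F.Cc η) : rep F η i (mk F η a) = (F.rep i).integ η a.fn :=
  rep_of F η i a.fn

lemma rep_sub (i : F.ι) (a b : F.GroupAlg η) : rep F η i (a - b) = rep F η i a - rep F η i b :=
  (denseRange_mk F η).induction_on₂
    (p := fun a b => rep F η i (a - b) = rep F η i a - rep F η i b)
    (isClosed_eq ((continuous_rep F η i).comp (continuous_fst.sub continuous_snd))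
      (((continuous_rep F η i).comp continuous_fst).sub
        ((continuous_rep F η i).comp continuous_snd)))
    (fun a b => by
      have : mk F η a - mk F η b = mk F η (a - b) := (Completion.coe_sub a b).symm
      rw [this, rep_mk, rep_mk, rep_mk]
      exact (Cc.integₗ F η i).map_sub a b) a b

lemma rep_mul (i : F.ι) (a b : F.GroupAlg η) : rep F η i (a * b) = rep F η i a * rep F η i b :=
  (denseRange_mk F η).induction_on₂
    (p := fun a b => rep F η i (a * b) = rep F η i a * rep F η i b)
    (isClosed_eq ((continuous_rep F η i).comp (continuous_fst.mul continuous_snd))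
      (((continuous_rep F η i).comp continuous_fst).mul
        ((continuous_rep F η i).comp continuous_snd)))
    (fun a b => by
      rw [← mk_mul, rep_mk, rep_mk, rep_mk]
      exact Cc.integₗ_mul i a b) a b

lemma norm_rep_le (i : F.ι) (a : F.GroupAlg η) : ‖rep F η i a‖ ≤ ‖a‖ :=
  (denseRange_mk F η).induction_on (p := fun a => ‖rep F η i a‖ ≤ ‖a‖) a
    (isClosed_le (continuous_rep F η i).norm continuous_norm)
    (fun a => by
      rw [rep_mk, norm_mk]
      exact Cc.norm_integ_le a i)

/-- The norm of `C_F(G)` is the supremum of the norms in the representations of the family. -/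
lemma norm_le {C : ℝ} (hC : 0 ≤ C) (a : F.GroupAlg η) (h : ∀ i, ‖rep F η i a‖ ≤ C) :
    ‖a‖ ≤ C := by
  refine le_of_forall_pos_le_add fun ε hε => ?_
  obtain ⟨b, hb⟩ := (denseRange_mk F η).exists_dist_lt a (half_pos hε)
  rw [dist_eq_norm] at hb
  have h1 : ‖mk F η b‖ ≤ C + ε / 2 := by
    rw [norm_mk]
    refine Cc.norm_le b (by positivity) fun i => ?_
    rw [← rep_mk]
    have h2 := norm_rep_le F η i (a - mk F η b)
    rw [rep_sub] at h2
    have h3 := norm_le_norm_add_norm_sub' (rep F η i (mk F η b)) (rep F η i a)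
    rw [norm_sub_rev] at h3
    linarith [h i]
  have := norm_le_norm_add_norm_sub' a (mk F η b)
  linarith

lemma ext_rep {a b : F.GroupAlg η} (h : ∀ i, rep F η i a = rep F η i b) : a = b := by
  rw [← sub_eq_zero, ← norm_le_zero_iff]
  refine norm_le F η le_rfl _ fun i => ?_
  rw [rep_sub, h i, sub_self, norm_zero]

end GroupAlg

end Rep

section Projection

variable {F : RepFamily.{u, v, w} G} {η : Measure G} [η.IsHaarMeasure]

/-- Two bounded projections onto `E^π` along `E_π` coincide. -/
lemma _root_.IsometricRep.IsFixedProjection.unique {E : Type v} [NormedAddCommGroup E]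
    [NormedSpace ℂ E] {π : IsometricRep G E} {S T : E →L[ℂ] E} (hS : π.IsFixedProjection S)
    (hT : π.IsFixedProjection T) : S = T := by
  ext v
  have h1 : v - T v ∈ T.ker := by
    have : T (T v) = T v := congrArg (fun A : E →L[ℂ] E => A v) hT.1
    simp [this]
  rw [hT.2.2, ← hS.2.2] at h1
  have h2 : T v ∈ T.range := ⟨v, rfl⟩
  rw [hT.2.1, ← hS.2.1] at h2
  obtain ⟨u, hu⟩ := h2
  have h3 : S (S u) = S u := congrArg (fun A : E →L[ℂ] E => A u) hS.1
  have h4 : S (v - T v) = 0 := h1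
  rw [map_sub, sub_eq_zero] at h4
  have h5 : S u = T v := hu
  rw [h4, ← h5, h3]

lemma GroupAlg.IsKazhdanProjection.unique {p q : F.GroupAlg η}
    (hp : GroupAlg.IsKazhdanProjection p) (hq : GroupAlg.IsKazhdanProjection q) : p = q :=
  GroupAlg.ext_rep F η fun i => (hp.2.2 i).unique (hq.2.2 i)

/-- An element of `C_F(G)` that every representation maps to the projection onto the fixed vectors
is automatically a central idempotent. -/
lemma GroupAlg.isKazhdanProjection_of_rep {p : F.GroupAlg η}
    (hp : ∀ i, (F.rep i).IsFixedProjection (GroupAlg.rep F η i p)) :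
    GroupAlg.IsKazhdanProjection p := by
  refine ⟨GroupAlg.ext_rep F η fun i => ?_, fun x => ?_, hp⟩
  · rw [GroupAlg.rep_mul]
    exact (hp i).1
  · refine (GroupAlg.denseRange_mk F η).induction_on (p := fun x => p * x = x * p) x
      (isClosed_eq (by fun_prop) (by fun_prop)) fun f => GroupAlg.ext_rep F η fun i => ?_
    rw [GroupAlg.rep_mul, GroupAlg.rep_mul, GroupAlg.rep_mk]
    obtain ⟨hid, hran, hker⟩ := hp i
    set P := GroupAlg.rep F η i p
    ext v
    have hP : P (P v) = P v := congrArg (fun A : F.E i →L[ℂ] F.E i => A v) hid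
    have h1 : P v ∈ (F.rep i).fixed := by
      rw [← hran]
      exact ⟨v, rfl⟩
    have h2 : v - P v ∈ (F.rep i).compl := by
      rw [← hker]
      simp [hP]
    have h3 := (F.rep i).integ_mem_compl η f.fn h2
    rw [← hker] at h3
    have h4 : P ((F.rep i).integ η f.fn (v - P v)) = 0 := h3
    rw [map_sub, map_sub, (F.rep i).integ_apply_of_mem_fixed η f.fn h1, map_smul, hP,
      sub_eq_zero] at h4
    rw [mul_apply_eq_comp, mul_apply_eq_comp, h4,
      (F.rep i).integ_apply_of_mem_fixed η f.fn h1]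

/-- A spectral gap over a uniformly convex family makes the convolution powers of a suitable
probability density converge to a Kazhdan projection. -/
theorem HasSpectralGap.exists_isKazhdanProjection (hF : F.IsUniformlyConvex)
    (hgap : F.HasSpectralGap) : ∃ p : F.GroupAlg η,
      GroupAlg.IsKazhdanProjection p ∧ GroupAlg.IsLimitOfConvPowers p := by
  obtain ⟨Q, κ, hQ, hκ, hpair⟩ := hgap
  obtain ⟨δ', hδ', hmod'⟩ := hF (κ / 2) (half_pos hκ)
  obtain ⟨δ, hδ, hδ1, hmod⟩ : ∃ δ, 0 < δ ∧ δ ≤ 1 ∧ ∀ i, ConvexityModulusGE (F.E i) (κ / 2) δ :=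
    ⟨min δ' 1, lt_min hδ' one_pos, min_le_right _ _, fun i x y hx hy hxy =>
      (min_le_left _ _).trans (hmod' i x y hx hy hxy)⟩
  obtain ⟨ρ, β, c', hc', hρ, hβ, hdom'⟩ := exists_probDensity_dominating η hQ
  -- Shrinking the constant makes the contraction factor `1 - 2 c δ` nonnegative.
  obtain ⟨c, hc, hc1, hdom⟩ : ∃ c, 0 < c ∧ c ≤ 1 / 2 ∧
      ∀ s ∈ Q, ∀ g, c * (β g).re + c * (β (s⁻¹ * g)).re ≤ (ρ g).re := by
    refine ⟨min c' (1 / 2), lt_min hc' (by norm_num), min_le_right _ _, fun s hs g =>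
      le_trans ?_ (hdom' s hs g)⟩
    exact add_le_add (mul_le_mul_of_nonneg_right (min_le_left _ _) (hβ.1 _).1)
      (mul_le_mul_of_nonneg_right (min_le_left _ _) (hβ.1 _).1)
  set r := 1 - 2 * c * δ with hr
  have hr0 : 0 ≤ r := by nlinarith
  have hr1 : r < 1 := by nlinarith [mul_pos hc hδ]
  have hcontr : ∀ i, ∀ v ∈ (F.rep i).compl, ‖(F.rep i).integ η ρ v‖ ≤ r * ‖v‖ := fun i v hv =>
    (F.rep i).norm_integ_le_of_isKazhdanPair hρ hβ hc.le hκ hδ1 hdom (hpair i) (hmod i) hv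
  have huc : ∀ i, ∀ t : ℝ, 0 < t → ∃ δ, 0 < δ ∧ ConvexityModulusGE (F.E i) t δ := fun i t ht => by
    obtain ⟨d, hd, h⟩ := hF t ht
    exact ⟨d, hd, h i⟩
  have hsplit : ∀ i v, ∃ x ∈ (F.rep i).fixed, (F.rep i).integ η ρ x = x ∧
      v - x ∈ (F.rep i).compl := fun i v =>
    (F.rep i).exists_mem_fixed_sub_mem_compl (huc i) hr0 hr1 ((F.rep i).integ_sub_mem_compl hρ)
      (hcontr i) ((F.rep i).norm_integ_apply_le hρ) v
  have hpow : ∀ i v x, (F.rep i).integ η ρ x = x → v - x ∈ (F.rep i).compl → ∀ k,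
      ‖((F.rep i).integ η ρ ^ k) v - x‖ ≤ r ^ k * ‖v - x‖ := fun i v x hx hvx k => by
    have := (pow_contraction hr0 ((F.rep i).integ_sub_mem_compl hρ) (hcontr i) hvx k).2
    rwa [map_sub, pow_apply_eq_self hx] at this
  have hlim : ∀ i v x, (F.rep i).integ η ρ x = x → v - x ∈ (F.rep i).compl →
      Tendsto (fun k => ((F.rep i).integ η ρ ^ k) v) atTop (𝓝 x) := fun i v x hx hvx => by
    rw [tendsto_iff_norm_sub_tendsto_zero]
    refine squeeze_zero (fun _ => norm_nonneg _) (hpow i v x hx hvx) ?_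
    simpa using (tendsto_pow_atTop_nhds_zero_of_lt_one hr0 hr1).mul_const ‖v - x‖
  -- The orbit of `v` under the contraction `π(ρ)` bounds its component in `E^π`.
  have hnorm : ∀ i v x, (F.rep i).integ η ρ x = x → v - x ∈ (F.rep i).compl →
      ‖v - x‖ ≤ 2 * ‖v‖ := fun i v x hx hvx => by
    have h1 : ‖x‖ ≤ ‖v‖ := by
      refine le_of_tendsto (hlim i v x hx hvx).norm (Eventually.of_forall fun k => ?_)
      induction k with
      | zero => simp
      | succ k ih =>
        rw [pow_succ', mul_apply_eq_comp]
        exact ((F.rep i).norm_integ_apply_le hρ _).trans ih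
    linarith [norm_sub_le v x]
  have hcau : CauchySeq fun k => GroupAlg.of F η (ccConvPow η ρ k) := by
    refine cauchySeq_of_le_geometric r 4 hr1 fun k => ?_
    rw [dist_eq_norm]
    refine GroupAlg.norm_le F η (by positivity) _ fun i => ?_
    rw [GroupAlg.rep_sub, GroupAlg.rep_of, GroupAlg.rep_of, integ_ccConvPow, integ_ccConvPow]
    refine ContinuousLinearMap.opNorm_le_bound _ (by positivity) fun v => ?_
    obtain ⟨x, -, hx, hvx⟩ := hsplit i v
    have h1 := hpow i v x hx hvx (k + 1)
    have h2 := hpow i v x hx hvx (k + 1 + 1)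
    have h3 := hnorm i v x hx hvx
    have hk : r ^ (k + 1) ≤ r ^ k := pow_le_pow_of_le_one hr0 hr1.le (Nat.le_succ _)
    have hk' : r ^ (k + 1 + 1) ≤ r ^ k := pow_le_pow_of_le_one hr0 hr1.le (by omega)
    have h4 : r ^ (k + 1) * ‖v - x‖ ≤ r ^ k * (2 * ‖v‖) := by gcongr
    have h5 : r ^ (k + 1 + 1) * ‖v - x‖ ≤ r ^ k * (2 * ‖v‖) := by gcongr
    have h6 := norm_sub_le ((((F.rep i).integ η ρ) ^ (k + 1)) v - x)
      ((((F.rep i).integ η ρ) ^ (k + 1 + 1)) v - x)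
    rw [sub_sub_sub_cancel_right] at h6
    rw [sub_apply]
    linarith
  obtain ⟨p, hp⟩ := cauchySeq_tendsto_of_complete hcau
  refine ⟨p, GroupAlg.isKazhdanProjection_of_rep fun i => ?_, ρ, hρ, hp⟩
  have hrep : ∀ v x, (F.rep i).integ η ρ x = x → v - x ∈ (F.rep i).compl →
      GroupAlg.rep F η i p v = x := fun v x hx hvx => by
    have h1 := ((GroupAlg.continuous_rep F η i).tendsto p).comp hp
    have h2 : Tendsto (fun k => GroupAlg.rep F η i (GroupAlg.of F η (ccConvPow η ρ k)) v) atTop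
        (𝓝 (GroupAlg.rep F η i p v)) :=
      ((ContinuousLinearMap.apply ℂ (F.E i) v).continuous.tendsto _).comp h1
    refine tendsto_nhds_unique h2 ?_
    simp only [GroupAlg.rep_of, integ_ccConvPow]
    exact (hlim i v x hx hvx).comp (tendsto_add_atTop_nat 1)
  have hfix : ∀ x ∈ (F.rep i).fixed, GroupAlg.rep F η i p x = x := fun x hx =>
    hrep x x (by rw [(F.rep i).integ_apply_of_mem_fixed η ρ hx, hρ.2, one_smul])
      (by rw [sub_self]; exact zero_mem _)
  refine ⟨?_, ?_, ?_⟩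
  · ext v
    obtain ⟨x, hxf, hx, hvx⟩ := hsplit i v
    rw [mul_apply_eq_comp, hrep v x hx hvx, hfix x hxf]
  · ext y
    constructor
    · rintro ⟨v, rfl⟩
      obtain ⟨x, hxf, hx, hvx⟩ := hsplit i v
      change GroupAlg.rep F η i p v ∈ _
      rwa [hrep v x hx hvx]
    · exact fun hy => ⟨y, hfix y hy⟩
  · ext v
    obtain ⟨x, hxf, hx, hvx⟩ := hsplit i v
    rw [LinearMap.mem_ker]
    change GroupAlg.rep F η i p v = 0 ↔ _
    constructor
    · intro h0
      rw [hrep v x hx hvx] at h0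
      rwa [h0, sub_zero] at hvx
    · intro hv
      have hz : (F.rep i).integ η ρ 0 = 0 := map_zero _
      exact hrep v 0 hz (by rwa [sub_zero])

/-- A function of `C_c(G)` close to a Kazhdan projection has integral close to `1`, by the trivial
representation, and nearly annihilates `E_π`; its support is then a Kazhdan set. -/
theorem GroupAlg.IsKazhdanProjection.hasSpectralGap (htriv : F.HasTrivialRep)
    {p : F.GroupAlg η} (hp : GroupAlg.IsKazhdanProjection p) : F.HasSpectralGap := by
  obtain ⟨f, hf⟩ := (GroupAlg.denseRange_mk F η).exists_dist_lt p (show (0 : ℝ) < 1 / 4 by norm_num)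
  rw [dist_eq_norm] at hf
  have hclose : ∀ i, ‖GroupAlg.rep F η i p - (F.rep i).integ η f.fn‖ ≤ 1 / 4 := fun i => by
    have := GroupAlg.norm_rep_le F η i (p - GroupAlg.mk F η f)
    rw [GroupAlg.rep_sub, GroupAlg.rep_mk] at this
    exact this.trans hf.le
  set I := ∫ g, f.fn g ∂η with hI
  set N := ∫ g, ‖f.fn g‖ ∂η with hN
  have hN0 : 0 ≤ N := integral_nonneg fun _ => norm_nonneg _
  have hI1 : 3 / 4 ≤ ‖I‖ := by
    obtain ⟨i, hi, htr⟩ := htriv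
    obtain ⟨v, hv⟩ := exists_ne (0 : F.E i)
    have hvf : v ∈ (F.rep i).fixed := fun g => htr g v
    have hpv : GroupAlg.rep F η i p v = v := by
      have h1 := hvf
      rw [← (hp.2.2 i).2.1] at h1
      obtain ⟨u, hu⟩ := h1
      have h2 : GroupAlg.rep F η i p u = v := hu
      rw [← h2]
      exact congrArg (fun A : F.E i →L[ℂ] F.E i => A u) (hp.2.2 i).1
    have h3 := ContinuousLinearMap.le_of_opNorm_le _ (hclose i) v
    rw [sub_apply, hpv, (F.rep i).integ_apply_of_mem_fixed η f.fn hvf] at h3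
    have h4 : v - I • v = (1 - I) • v := by rw [sub_smul, one_smul]
    rw [h4, norm_smul] at h3
    have h5 := le_of_mul_le_mul_right h3 (norm_pos_iff.2 hv)
    have h6 := norm_sub_norm_le 1 I
    rw [norm_one] at h6
    linarith
  refine ⟨tsupport f.fn, 1 / (2 * (N + 1)), f.fn.hasCompactSupport, by positivity,
    fun i v hv => ?_⟩
  set S := ⨆ s : tsupport f.fn, ‖v - F.rep i s v‖ with hS
  have hbdd : BddAbove (Set.range fun s : tsupport f.fn => ‖v - F.rep i s v‖) :=
    ⟨2 * ‖v‖, Set.forall_mem_range.2 fun s => by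
      have := norm_sub_le v (F.rep i s v)
      rw [LinearIsometryEquiv.norm_map] at this
      linarith⟩
  have hS0 : 0 ≤ S := Real.iSup_nonneg fun _ => norm_nonneg _
  have hpv : GroupAlg.rep F η i p v = 0 := by
    rw [← (hp.2.2 i).2.2] at hv
    exact hv
  have h1 := ContinuousLinearMap.le_of_opNorm_le _ (hclose i) v
  rw [sub_apply, hpv, zero_sub, norm_neg] at h1
  have h2 : ‖I • v - (F.rep i).integ η f.fn v‖ ≤ N * S := by
    have e : I • v - (F.rep i).integ η f.fn v = ∫ g, f.fn g • (v - F.rep i g v) ∂η := by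
      rw [IsometricRep.integ_apply, hI, ← integral_smul_const, ← integral_sub
        ((f.fn.integrable).smul_const v) ((F.rep i).integrable_smul_orbit η f.fn v)]
      simp only [smul_sub]
    rw [e, hN, ← integral_mul_const]
    refine norm_integral_le_of_norm_le ((f.fn.integrable).norm.mul_const S)
      (ae_of_all _ fun g => ?_)
    rw [norm_smul]
    by_cases hg : g ∈ tsupport f.fn
    · exact mul_le_mul_of_nonneg_left (le_ciSup hbdd ⟨g, hg⟩) (norm_nonneg _)
    · rw [image_eq_zero_of_notMem_tsupport hg]
      simp
  have h3 : ‖I • v‖ ≤ N * S + 1 / 4 * ‖v‖ := by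
    have := norm_le_norm_add_norm_sub' (I • v) ((F.rep i).integ η f.fn v)
    linarith
  rw [norm_smul] at h3
  have h4 := mul_le_mul_of_nonneg_right hI1 (norm_nonneg v)
  rw [div_mul_eq_mul_div, one_mul, div_le_iff₀ (by positivity)]
  nlinarith

/-- The case of a single space: the trivial representation belongs to the family unless the space
is zero, and then every pair is a Kazhdan pair. -/
theorem GroupAlg.IsKazhdanProjection.hasUniformTE {E : Type v} [NormedAddCommGroup E]
    [NormedSpace ℂ E] [CompleteSpace E] {p : (allOn G E).GroupAlg η}
    (hp : GroupAlg.IsKazhdanProjection p) : HasUniformTE G E := by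
  rcases subsingleton_or_nontrivial E with hE | hE
  · refine ⟨∅, 1, isCompact_empty, one_pos, fun i v _ => ?_⟩
    rw [Real.iSup_of_isEmpty, show v = 0 from Subsingleton.elim (α := E) _ _]
    simp
  · exact hp.hasSpectralGap ⟨{ toHom := 1, continuous_orbit := fun v => continuous_const },
      hE, fun g v => rfl⟩

lemma isUniformlyConvex_allOn {E : Type v} [NormedAddCommGroup E]
    [NormedSpace ℂ E] [CompleteSpace E] [UniformConvexSpace E] :
    (allOn G E).IsUniformlyConvex := fun t ht => by
  obtain ⟨δ, hδ, h⟩ := exists_forall_sphere_dist_add_le_two_sub E ht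
  refine ⟨δ / 2, half_pos hδ, fun i x y hx hy hxy => ?_⟩
  have : ‖x + y‖ ≤ 2 - δ := h hx hy hxy
  rw [norm_smul]
  norm_num
  linarith

end Projection

end RepFamily

/-! ### Homogeneous inequalities and the pointwise Mazur map -/

section Pointwise

/-- If `A` and `B ≥ 0` are continuous and homogeneous of the same degree, and `A ≤ 0` wherever
`B = 0`, then compactness of the sphere bounds `A` by a multiple of `B` up to a small error. -/
lemma exists_le_add_mul_of_homogeneous {p : ℝ} (hp : 0 < p) {A B : ℂ × ℂ → ℝ} (hA : Continuous A)
    (hB : Continuous B) (hAh : ∀ t : ℝ, 0 < t → ∀ z, A (t • z) = t ^ p * A z)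
    (hBh : ∀ t : ℝ, 0 < t → ∀ z, B (t • z) = t ^ p * B z) (hB0 : ∀ z, 0 ≤ B z)
    (hAB : ∀ z, B z = 0 → A z ≤ 0) {ε : ℝ} (hε : 0 < ε) :
    ∃ C : ℝ, 0 ≤ C ∧ ∀ a b : ℂ, A (a, b) ≤ ε * (‖a‖ ^ p + ‖b‖ ^ p) + C * B (a, b) := by
  have hsphere : ∃ C : ℝ, 0 ≤ C ∧ ∀ z : ℂ × ℂ, ‖z‖ = 1 → A z ≤ ε + C * B z := by
    let K : Set (ℂ × ℂ) := Metric.sphere 0 1 ∩ {z | ε ≤ A z}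
    have hK : IsCompact K := (isCompact_sphere _ _).inter_right (isClosed_le continuous_const hA)
    rcases K.eq_empty_or_nonempty with hKe | hKn
    · refine ⟨0, le_rfl, fun z hz => ?_⟩
      by_contra! hcon
      have : z ∈ K := ⟨by simpa using hz, by simpa using hcon.le⟩
      simp [hKe] at this
    · obtain ⟨z₀, hz₀, hmin⟩ := hK.exists_isMinOn hKn hB.continuousOn
      obtain ⟨z₁, hz₁, hmax⟩ := hK.exists_isMaxOn hKn hA.continuousOn
      have hd : 0 < B z₀ := (hB0 z₀).lt_of_ne fun h => by
        have h1 := hAB z₀ h.symm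
        have h2 : ε ≤ A z₀ := hz₀.2
        linarith
      have hM : 0 ≤ A z₁ := hε.le.trans hz₁.2
      refine ⟨A z₁ / B z₀, by positivity, fun z hz => ?_⟩
      by_cases hzK : ε ≤ A z
      · have hz' : z ∈ K := ⟨by simpa using hz, hzK⟩
        have h1 : A z ≤ A z₁ := hmax hz'
        have h2 : B z₀ ≤ B z := hmin hz'
        have h3 : A z₁ ≤ A z₁ / B z₀ * B z := by
          rw [div_mul_eq_mul_div, le_div_iff₀ hd]
          exact mul_le_mul_of_nonneg_left h2 hM
        linarith
      · have : 0 ≤ A z₁ / B z₀ * B z := mul_nonneg (by positivity) (hB0 z)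
        linarith
  obtain ⟨C, hC, h⟩ := hsphere
  refine ⟨C, hC, fun a b => ?_⟩
  have hsum : ‖((a, b) : ℂ × ℂ)‖ ^ p ≤ ‖a‖ ^ p + ‖b‖ ^ p := by
    have ha : 0 ≤ ‖a‖ ^ p := by positivity
    have hb : 0 ≤ ‖b‖ ^ p := by positivity
    rw [Prod.norm_mk]
    rcases max_choice ‖a‖ ‖b‖ with hm | hm <;> rw [hm] <;> linarith
  rcases eq_or_ne ((a, b) : ℂ × ℂ) 0 with hz | hz
  · rw [hz]
    have h0 : B 0 = 0 := by
      have := hBh 2 two_pos 0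
      have h2 : (1 : ℝ) < 2 ^ p := Real.one_lt_rpow one_lt_two hp
      rw [smul_zero] at this
      nlinarith
    have h1 : 0 ≤ ε * (‖a‖ ^ p + ‖b‖ ^ p) := by positivity
    rw [h0, mul_zero, add_zero]
    exact (hAB 0 h0).trans h1
  · set N := ‖((a, b) : ℂ × ℂ)‖ with hN
    have hNpos : 0 < N := norm_pos_iff.2 hz
    have h1 := h (N⁻¹ • (a, b)) (by
      rw [norm_smul, norm_inv, norm_norm, inv_mul_cancel₀ hNpos.ne'])
    rw [hAh _ (inv_pos.2 hNpos), hBh _ (inv_pos.2 hNpos), Real.inv_rpow hNpos.le] at h1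
    have hNp : 0 < N ^ p := Real.rpow_pos_of_pos hNpos p
    have h2 := mul_le_mul_of_nonneg_left h1 hNp.le
    rw [mul_add, mul_inv_cancel_left₀ hNp.ne', mul_left_comm C, mul_inv_cancel_left₀ hNp.ne'] at h2
    have h3 := mul_le_mul_of_nonneg_right hsum hε.le
    linarith

/-- The pointwise Mazur map `z ↦ z |z|^(θ - 1)`, which raises the absolute value to the power
`θ` and keeps the argument. -/
def powSign (θ : ℝ) (z : ℂ) : ℂ := ((‖z‖ ^ (θ - 1) : ℝ) : ℂ) * z

lemma powSign_zero (θ : ℝ) : powSign θ 0 = 0 := mul_zero _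

lemma norm_powSign {θ : ℝ} (hθ : 0 < θ) (z : ℂ) : ‖powSign θ z‖ = ‖z‖ ^ θ := by
  rcases eq_or_ne z 0 with rfl | hz
  · rw [powSign_zero, norm_zero, Real.zero_rpow hθ.ne']
  · rw [powSign, norm_mul, Complex.norm_real, Real.norm_of_nonneg (by positivity),
      Real.rpow_sub_one (norm_ne_zero_iff.2 hz), div_mul_cancel₀ _ (norm_ne_zero_iff.2 hz)]

lemma powSign_mul (θ : ℝ) (z w : ℂ) : powSign θ (z * w) = powSign θ z * powSign θ w := by
  rw [powSign, powSign, powSign, norm_mul, Real.mul_rpow (norm_nonneg _) (norm_nonneg _)]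
  push_cast
  ring

lemma powSign_powSign {θ θ' : ℝ} (hθ : 0 < θ) (z : ℂ) :
    powSign θ' (powSign θ z) = powSign (θ * θ') z := by
  rcases eq_or_ne z 0 with rfl | hz
  · simp only [powSign_zero]
  · rw [powSign, norm_powSign hθ, powSign, powSign, ← Real.rpow_mul (norm_nonneg _), ← mul_assoc,
      ← Complex.ofReal_mul, ← Real.rpow_add (norm_pos_iff.2 hz)]
    ring_nf

lemma powSign_one (z : ℂ) : powSign 1 z = z := by simp [powSign]

lemma powSign_ofReal {θ : ℝ} {t : ℝ} (ht : 0 < t) : powSign θ t = ((t ^ θ : ℝ) : ℂ) := by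
  rw [powSign, Complex.norm_real, Real.norm_of_nonneg ht.le, ← Complex.ofReal_mul,
    Real.rpow_sub_one ht.ne', div_mul_cancel₀ _ ht.ne']

lemma continuous_powSign {θ : ℝ} (hθ : 0 < θ) : Continuous (powSign θ) := by
  rw [continuous_iff_continuousAt]
  intro z
  rcases eq_or_ne z 0 with rfl | hz
  · rw [ContinuousAt, powSign_zero, tendsto_zero_iff_norm_tendsto_zero]
    simp only [norm_powSign hθ]
    have : Continuous fun z : ℂ => ‖z‖ ^ θ := continuous_norm.rpow_const fun _ => Or.inr hθ.le
    simpa [Real.zero_rpow hθ.ne'] using this.tendsto 0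
  · exact (Complex.continuous_ofReal.continuousAt.comp
      (continuous_norm.continuousAt.rpow_const (Or.inl (norm_ne_zero_iff.2 hz)))).mul
        continuousAt_id

lemma continuous_norm_rpow {Y : Type*} [TopologicalSpace Y] {f : Y → ℂ} (hf : Continuous f)
    {p : ℝ} (hp : 0 < p) : Continuous fun y => ‖f y‖ ^ p :=
  hf.norm.rpow_const fun _ => Or.inr hp.le

lemma norm_smul_rpow {t : ℝ} (ht : 0 < t) (p : ℝ) (z : ℂ) : ‖t • z‖ ^ p = t ^ p * ‖z‖ ^ p := by
  rw [norm_smul, Real.norm_of_nonneg ht.le, Real.mul_rpow ht.le (norm_nonneg _)]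

/-- The Mazur map is uniformly continuous on bounded sets, in a form that can be integrated. -/
lemma exists_norm_powSign_sub_rpow_le {p r : ℝ} (hp : 0 < p) (hr : 0 < r) {ε : ℝ} (hε : 0 < ε) :
    ∃ C : ℝ, 0 ≤ C ∧ ∀ a b : ℂ, ‖powSign (p / r) a - powSign (p / r) b‖ ^ r ≤
      ε * (‖a‖ ^ p + ‖b‖ ^ p) + C * ‖a - b‖ ^ p := by
  have hθ : 0 < p / r := div_pos hp hr
  refine exists_le_add_mul_of_homogeneous hp
    (A := fun z => ‖powSign (p / r) z.1 - powSign (p / r) z.2‖ ^ r)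
    (B := fun z => ‖z.1 - z.2‖ ^ p) ?_ ?_ ?_ ?_ (fun z => by positivity) ?_ hε
  · exact continuous_norm_rpow (((continuous_powSign hθ).comp continuous_fst).sub
      ((continuous_powSign hθ).comp continuous_snd)) hr
  · exact continuous_norm_rpow (continuous_fst.sub continuous_snd) hp
  · intro t ht z
    have h1 : ∀ w : ℂ, powSign (p / r) (t • w) = (t ^ (p / r) : ℝ) • powSign (p / r) w := fun w => by
      rw [Complex.real_smul, powSign_mul, powSign_ofReal ht, Complex.real_smul]
    simp only [Prod.smul_fst, Prod.smul_snd]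
    rw [h1, h1, ← smul_sub, norm_smul_rpow (Real.rpow_pos_of_pos ht _), ← Real.rpow_mul ht.le,
      div_mul_cancel₀ _ hr.ne']
  · intro t ht z
    simp only [Prod.smul_fst, Prod.smul_snd]
    rw [← smul_sub, norm_smul_rpow ht]
  · intro z hz
    have : z.1 = z.2 := by
      rw [Real.rpow_eq_zero (norm_nonneg _) hp.ne', norm_eq_zero, sub_eq_zero] at hz
      exact hz
    simp [this, Real.zero_rpow hr.ne']

lemma norm_midpoint_rpow_le {p : ℝ} (hp : 1 ≤ p) (a b : ℂ) :
    ‖(2⁻¹ : ℂ) * (a + b)‖ ^ p ≤ (‖a‖ ^ p + ‖b‖ ^ p) / 2 := by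
  have h1 : ‖(2⁻¹ : ℂ) * (a + b)‖ ≤ (1 / 2 : ℝ) * ‖a‖ + (1 / 2 : ℝ) * ‖b‖ := by
    rw [norm_mul]
    norm_num
    linarith [norm_add_le a b]
  have h2 := (convexOn_rpow hp).2 (norm_nonneg a) (norm_nonneg b)
    (show (0 : ℝ) ≤ 1 / 2 by norm_num) (show (0 : ℝ) ≤ 1 / 2 by norm_num) (by norm_num)
  simp only [smul_eq_mul] at h2
  exact (Real.rpow_le_rpow (norm_nonneg _) h1 (by linarith)).trans (by linarith)

lemma eq_of_norm_midpoint_rpow_eq {p : ℝ} (hp : 1 < p) {a b : ℂ}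
    (h : ‖(2⁻¹ : ℂ) * (a + b)‖ ^ p = (‖a‖ ^ p + ‖b‖ ^ p) / 2) : a = b := by
  have hn : ‖(2⁻¹ : ℂ) * (a + b)‖ = ‖a + b‖ / 2 := by
    rw [norm_mul]
    norm_num
    ring
  have hle : ‖a + b‖ / 2 ≤ (1 / 2 : ℝ) * ‖a‖ + (1 / 2 : ℝ) * ‖b‖ := by
    linarith [norm_add_le a b]
  have hle' := Real.rpow_le_rpow (by positivity) hle (show (0 : ℝ) ≤ p by linarith)
  rw [hn] at h
  have hab : ‖a‖ = ‖b‖ := by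
    by_contra hne
    have h2 := (strictConvexOn_rpow hp).2 (norm_nonneg a) (norm_nonneg b) hne
      (show (0 : ℝ) < 1 / 2 by norm_num) (show (0 : ℝ) < 1 / 2 by norm_num) (by norm_num)
    simp only [smul_eq_mul] at h2
    linarith
  refine eq_of_norm_eq_of_norm_add_eq hab (le_antisymm (norm_add_le _ _) ?_)
  rw [hab, add_self_div_two] at h
  have := Real.rpow_left_injOn (show p ≠ 0 by linarith)
    (show ‖a + b‖ / 2 ∈ Set.Ici 0 by simp only [Set.mem_Ici]; positivity) (norm_nonneg b) h
  linarith

/-- Uniform convexity of `ℂ`, in a form that can be integrated. -/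
lemma exists_norm_sub_rpow_le {p : ℝ} (hp : 1 < p) {ε : ℝ} (hε : 0 < ε) :
    ∃ C : ℝ, 0 ≤ C ∧ ∀ a b : ℂ, ‖a - b‖ ^ p ≤ ε * (‖a‖ ^ p + ‖b‖ ^ p) +
      C * ((‖a‖ ^ p + ‖b‖ ^ p) / 2 - ‖(2⁻¹ : ℂ) * (a + b)‖ ^ p) := by
  have hp0 : 0 < p := by linarith
  refine exists_le_add_mul_of_homogeneous hp0
    (A := fun z => ‖z.1 - z.2‖ ^ p)
    (B := fun z => (‖z.1‖ ^ p + ‖z.2‖ ^ p) / 2 - ‖(2⁻¹ : ℂ) * (z.1 + z.2)‖ ^ p) ?_ ?_ ?_ ?_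
    (fun z => sub_nonneg.2 (norm_midpoint_rpow_le hp.le _ _)) ?_ hε
  · exact continuous_norm_rpow (continuous_fst.sub continuous_snd) hp0
  · exact (((continuous_norm_rpow continuous_fst hp0).add
      (continuous_norm_rpow continuous_snd hp0)).div_const 2).sub
      (continuous_norm_rpow (continuous_const.mul (continuous_fst.add continuous_snd)) hp0)
  · intro t ht z
    simp only [Prod.smul_fst, Prod.smul_snd]
    rw [← smul_sub, norm_smul_rpow ht]
  · intro t ht z
    simp only [Prod.smul_fst, Prod.smul_snd]
    rw [← smul_add, mul_smul_comm, norm_smul_rpow ht, norm_smul_rpow ht, norm_smul_rpow ht]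
    ring
  · intro z hz
    rw [eq_of_norm_midpoint_rpow_eq hp (sub_eq_zero.1 hz).symm, sub_self, norm_zero,
      Real.zero_rpow hp0.ne']

end Pointwise

/-! ### The Mazur map between `L_p`-spaces and uniform convexity -/

section Mazur

variable {X : Type v} [MeasurableSpace X] {ν : Measure X} {p r : ℝ≥0∞}
  [hp1 : Fact (1 ≤ p)] [hr1 : Fact (1 ≤ r)]

lemma toReal_pos_of_fact (hp : p ≠ ∞) : 0 < p.toReal :=
  ENNReal.toReal_pos (one_pos.trans_le hp1.out).ne' hp

lemma Lp.integrable_norm_rpow (hp : p ≠ ∞) (f : Lp ℂ p ν) :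
    Integrable (fun x => ‖f x‖ ^ p.toReal) ν :=
  (Lp.memLp f).integrable_norm_rpow (one_pos.trans_le hp1.out).ne' hp

lemma Lp.norm_rpow_eq_integral (hp : p ≠ ∞) (f : Lp ℂ p ν) :
    ‖f‖ ^ p.toReal = ∫ x, ‖f x‖ ^ p.toReal ∂ν := by
  rw [Lp.norm_def, toReal_eLpNorm (Lp.aestronglyMeasurable f),
    lpNorm_eq_integral_norm_rpow_toReal (one_pos.trans_le hp1.out).ne' hp
      (Lp.aestronglyMeasurable f), Real.rpow_inv_rpow
      (integral_nonneg fun x => by positivity) (toReal_pos_of_fact hp).ne']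

lemma Lp.norm_rpow_eq_integral_of_ae (hp : p ≠ ∞) (f : Lp ℂ p ν) {g : X → ℂ} (h : f =ᵐ[ν] g) :
    ‖f‖ ^ p.toReal = ∫ x, ‖g x‖ ^ p.toReal ∂ν ∧ Integrable (fun x => ‖g x‖ ^ p.toReal) ν := by
  have h' : (fun x => ‖f x‖ ^ p.toReal) =ᵐ[ν] fun x => ‖g x‖ ^ p.toReal := by
    filter_upwards [h] with x hx
    rw [hx]
  exact ⟨(Lp.norm_rpow_eq_integral hp f).trans (integral_congr_ae h'),
    (Lp.integrable_norm_rpow hp f).congr h'⟩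

lemma memLp_powSign (hp : p ≠ ∞) (hr : r ≠ ∞) (f : Lp ℂ p ν) :
    MemLp (fun x => powSign (p.toReal / r.toReal) (f x)) r ν := by
  have hP := toReal_pos_of_fact hp
  have hR := toReal_pos_of_fact hr
  rw [← integrable_norm_rpow_iff ((continuous_powSign (div_pos hP hR)).comp_aestronglyMeasurable
    (Lp.aestronglyMeasurable f)) (one_pos.trans_le hr1.out).ne' hr]
  refine (Lp.integrable_norm_rpow hp f).congr (ae_of_all _ fun x => ?_)
  change _ = ‖powSign (p.toReal / r.toReal) (f x)‖ ^ r.toReal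
  rw [norm_powSign (div_pos hP hR), ← Real.rpow_mul (norm_nonneg _), div_mul_cancel₀ _ hR.ne']

/-- The Mazur map `L_p → L_r`, `f ↦ f |f|^(p/r - 1)`. -/
def mazur (hp : p ≠ ∞) (hr : r ≠ ∞) (f : Lp ℂ p ν) : Lp ℂ r ν := (memLp_powSign hp hr f).toLp _

variable (hp : p ≠ ∞) (hr : r ≠ ∞)

lemma coeFn_mazur (f : Lp ℂ p ν) :
    mazur hp hr f =ᵐ[ν] fun x => powSign (p.toReal / r.toReal) (f x) :=
  (memLp_powSign hp hr f).coeFn_toLp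

lemma norm_mazur_rpow (f : Lp ℂ p ν) : ‖mazur hp hr f‖ ^ r.toReal = ‖f‖ ^ p.toReal := by
  have hP := toReal_pos_of_fact hp
  have hR := toReal_pos_of_fact hr
  rw [(Lp.norm_rpow_eq_integral_of_ae hr _ (coeFn_mazur hp hr f)).1, Lp.norm_rpow_eq_integral hp]
  refine integral_congr_ae (ae_of_all _ fun x => ?_)
  change ‖powSign (p.toReal / r.toReal) (f x)‖ ^ r.toReal = _
  rw [norm_powSign (div_pos hP hR), ← Real.rpow_mul (norm_nonneg _), div_mul_cancel₀ _ hR.ne']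

lemma mazur_mazur (f : Lp ℂ p ν) : mazur hr hp (mazur hp hr f) = f := by
  have hP := toReal_pos_of_fact hp
  have hR := toReal_pos_of_fact hr
  refine Lp.ext ?_
  filter_upwards [coeFn_mazur hr hp (mazur hp hr f), coeFn_mazur hp hr f] with x h1 h2
  rw [h1, h2, powSign_powSign (div_pos hP hR), div_mul_div_cancel₀ hR.ne', div_self hP.ne',
    powSign_one]

lemma mazur_smul (c : ℂ) (f : Lp ℂ p ν) :
    mazur hp hr (c • f) = powSign (p.toReal / r.toReal) c • mazur hp hr f := by
  refine Lp.ext ?_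
  filter_upwards [coeFn_mazur hp hr (c • f), coeFn_mazur hp hr f, Lp.coeFn_smul c f,
    Lp.coeFn_smul (powSign (p.toReal / r.toReal) c) (mazur hp hr f)] with x h1 h2 h3 h4
  rw [h1, h3, h4, Pi.smul_apply, Pi.smul_apply, h2, smul_eq_mul, smul_eq_mul, powSign_mul]

/-- The Mazur map is uniformly continuous on balls, uniformly over all measure spaces. -/
lemma exists_norm_mazur_sub_lt (R : ℝ) {e : ℝ} (he : 0 < e) :
    ∃ d : ℝ, 0 < d ∧ ∀ (X : Type v) [MeasurableSpace X] (ν : Measure X) (f g : Lp ℂ p ν),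
      ‖f‖ ≤ R → ‖g‖ ≤ R → ‖f - g‖ < d → ‖mazur hp hr f - mazur hp hr g‖ < e := by
  have hP := toReal_pos_of_fact hp
  have hR := toReal_pos_of_fact hr
  set M : ℝ := 2 * (|R| ^ p.toReal) + 1 with hM
  have hM0 : 0 < M := by positivity
  have her : 0 < e ^ r.toReal := Real.rpow_pos_of_pos he _
  obtain ⟨C, hC, h⟩ := exists_norm_powSign_sub_rpow_le hP hR
    (show 0 < e ^ r.toReal / (2 * M) by positivity)
  refine ⟨(e ^ r.toReal / (2 * (C + 1))) ^ p.toReal⁻¹, by positivity, ?_⟩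
  intro X _ ν f g hf hg hfg
  have hd : ‖f - g‖ ^ p.toReal < e ^ r.toReal / (2 * (C + 1)) := by
    have := Real.rpow_lt_rpow (norm_nonneg _) hfg hP
    rwa [Real.rpow_inv_rpow (by positivity) hP.ne'] at this
  have hb : ∀ f : Lp ℂ p ν, ‖f‖ ≤ R → ‖f‖ ^ p.toReal ≤ |R| ^ p.toReal := fun f hf =>
    Real.rpow_le_rpow (norm_nonneg _) (hf.trans (le_abs_self R)) hP.le
  have e1 : (mazur hp hr f - mazur hp hr g : Lp ℂ r ν) =ᵐ[ν]
      fun x => powSign (p.toReal / r.toReal) (f x) - powSign (p.toReal / r.toReal) (g x) := by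
    filter_upwards [Lp.coeFn_sub (mazur hp hr f) (mazur hp hr g), coeFn_mazur hp hr f,
      coeFn_mazur hp hr g] with x h1 h2 h3
    rw [h1, Pi.sub_apply, h2, h3]
  obtain ⟨e2, i2⟩ := Lp.norm_rpow_eq_integral_of_ae hp (f - g) (g := fun x => f x - g x)
    (Lp.coeFn_sub f g)
  obtain ⟨e3, i3⟩ := Lp.norm_rpow_eq_integral_of_ae hr _ e1
  have if' := Lp.integrable_norm_rpow hp f
  have ig' := Lp.integrable_norm_rpow hp g
  have ifg : Integrable (fun x => ‖f x‖ ^ p.toReal + ‖g x‖ ^ p.toReal) ν := if'.add ig'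
  have key : ‖mazur hp hr f - mazur hp hr g‖ ^ r.toReal ≤
      e ^ r.toReal / (2 * M) * (‖f‖ ^ p.toReal + ‖g‖ ^ p.toReal) + C * ‖f - g‖ ^ p.toReal := by
    rw [e3, Lp.norm_rpow_eq_integral hp f, Lp.norm_rpow_eq_integral hp g, e2,
      ← integral_add if' ig', ← integral_const_mul, ← integral_const_mul,
      ← integral_add (ifg.const_mul _) (i2.const_mul _)]
    exact integral_mono i3 ((ifg.const_mul _).add (i2.const_mul _))
      fun x => h (f x) (g x)
  have h1 : e ^ r.toReal / (2 * M) * (‖f‖ ^ p.toReal + ‖g‖ ^ p.toReal) ≤ e ^ r.toReal / 2 := by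
    rw [div_mul_eq_mul_div, div_le_div_iff₀ (by positivity) two_pos]
    nlinarith [hb f hf, hb g hg]
  have h2 : C * ‖f - g‖ ^ p.toReal < e ^ r.toReal / 2 := by
    have h3 : (C + 1) * ‖f - g‖ ^ p.toReal < e ^ r.toReal / 2 := by
      rw [lt_div_iff₀ (by positivity)] at hd
      linarith
    have h4 : 0 ≤ ‖f - g‖ ^ p.toReal := by positivity
    linarith
  exact (Real.rpow_lt_rpow_iff (norm_nonneg _) he.le hR).1 (by linarith)

lemma continuous_mazur : Continuous (mazur hp hr : Lp ℂ p ν → Lp ℂ r ν) := by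
  refine Metric.continuous_iff.2 fun f e he => ?_
  obtain ⟨d, hd, h⟩ := exists_norm_mazur_sub_lt hp hr (‖f‖ + 1) he
  refine ⟨min d 1, lt_min hd one_pos, fun g hg => ?_⟩
  rw [dist_eq_norm] at hg ⊢
  refine h X ν g f ?_ (by linarith) (hg.trans_le (min_le_left _ _))
  have := norm_le_norm_add_norm_sub' g f
  linarith [hg.trans_le (min_le_right d 1)]

/-- `L_p`-spaces are uniformly convex for `1 < p < ∞`, with a modulus that does not depend on the
measure space. -/
lemma exists_convexityModulusGE_Lp (hp : p ≠ ∞) (h1p : 1 < p) {t : ℝ} (ht : 0 < t) :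
    ∃ δ : ℝ, 0 < δ ∧ ∀ (X : Type v) [MeasurableSpace X] (ν : Measure X),
      ConvexityModulusGE (Lp ℂ p ν) t δ := by
  have hP := toReal_pos_of_fact hp
  have hP1 : 1 < p.toReal := by
    rw [← ENNReal.toReal_one]
    exact (ENNReal.toReal_lt_toReal ENNReal.one_ne_top hp).2 h1p
  have htp : 0 < t ^ p.toReal := Real.rpow_pos_of_pos ht _
  obtain ⟨C, hC, h⟩ := exists_norm_sub_rpow_le hP1 (show 0 < t ^ p.toReal / 4 by positivity)
  have hu : 0 < t ^ p.toReal / (2 * (C + 1)) := by positivity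
  set u := min (t ^ p.toReal / (2 * (C + 1))) 1 with hudef
  have hu0 : 0 < u := lt_min hu one_pos
  have hu1 : u ≤ 1 := min_le_right _ _
  refine ⟨1 - (1 - u) ^ p.toReal⁻¹, ?_, ?_⟩
  · have := Real.rpow_lt_one (show 0 ≤ 1 - u by linarith) (by linarith) (inv_pos.2 hP)
    linarith
  intro X _ ν f g hf hg hfg
  have e1 : ((2⁻¹ : ℂ) • (f + g) : Lp ℂ p ν) =ᵐ[ν] fun x => (2⁻¹ : ℂ) * (f x + g x) := by
    filter_upwards [Lp.coeFn_smul (2⁻¹ : ℂ) (f + g), Lp.coeFn_add f g] with x h1 h2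
    rw [h1, Pi.smul_apply, h2, Pi.add_apply, smul_eq_mul]
  obtain ⟨e2, i2⟩ := Lp.norm_rpow_eq_integral_of_ae hp (f - g) (g := fun x => f x - g x)
    (Lp.coeFn_sub f g)
  obtain ⟨e3, i3⟩ := Lp.norm_rpow_eq_integral_of_ae hp _ e1
  have if' := Lp.integrable_norm_rpow hp f
  have ig' := Lp.integrable_norm_rpow hp g
  have ifg : Integrable (fun x => ‖f x‖ ^ p.toReal + ‖g x‖ ^ p.toReal) ν := if'.add ig'
  have i4 : Integrable (fun x => (‖f x‖ ^ p.toReal + ‖g x‖ ^ p.toReal) / 2 -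
      ‖(2⁻¹ : ℂ) * (f x + g x)‖ ^ p.toReal) ν := (ifg.div_const 2).sub i3
  have key : ‖f - g‖ ^ p.toReal ≤ t ^ p.toReal / 4 * (‖f‖ ^ p.toReal + ‖g‖ ^ p.toReal) +
      C * ((‖f‖ ^ p.toReal + ‖g‖ ^ p.toReal) / 2 - ‖(2⁻¹ : ℂ) • (f + g)‖ ^ p.toReal) := by
    rw [e3, Lp.norm_rpow_eq_integral hp f, Lp.norm_rpow_eq_integral hp g, e2,
      ← integral_add if' ig', ← integral_div, ← integral_sub (ifg.div_const 2) i3,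
      ← integral_const_mul, ← integral_const_mul,
      ← integral_add (ifg.const_mul _) (i4.const_mul _)]
    exact integral_mono i2 ((ifg.const_mul _).add (i4.const_mul _))
      fun x => h (f x) (g x)
  have ht' : t ^ p.toReal ≤ ‖f - g‖ ^ p.toReal := Real.rpow_le_rpow ht.le hfg hP.le
  rw [hf, hg, Real.one_rpow] at key
  set m := ‖(2⁻¹ : ℂ) • (f + g)‖ with hm
  have hm0 : 0 ≤ m := norm_nonneg _
  have hm1 : m ≤ 1 := by
    rw [hm, norm_smul]
    have := norm_add_le f g
    norm_num
    linarith
  have hmp1 : m ^ p.toReal ≤ 1 := Real.rpow_le_one hm0 hm1 hP.le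
  have h5 : t ^ p.toReal / (2 * (C + 1)) ≤ 1 - m ^ p.toReal := by
    rw [div_le_iff₀ (by positivity)]
    nlinarith
  have h6 : m ^ p.toReal ≤ 1 - u := by
    have := min_le_left (t ^ p.toReal / (2 * (C + 1))) 1
    linarith
  have h7 : m ≤ (1 - u) ^ p.toReal⁻¹ := by
    have := Real.rpow_le_rpow (by positivity) h6 (inv_pos.2 hP).le
    rwa [Real.rpow_rpow_inv hm0 hP.ne'] at this
  linarith

end Mazur

/-! ### Isometries of `L_p` preserve disjointness of supports for `p ≠ 2` -/

section Clarkson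

lemma add_rpow_lt_rpow_add {A B s : ℝ} (hA : 0 < A) (hB : 0 < B) (hs : 1 < s) :
    A ^ s + B ^ s < (A + B) ^ s := by
  have h : ∀ x : ℝ, 0 < x → x ^ s = x * x ^ (s - 1) := fun x hx => by
    rw [Real.rpow_sub_one hx.ne', mul_div_cancel₀ _ hx.ne']
  have h1 : A ^ (s - 1) < (A + B) ^ (s - 1) :=
    Real.rpow_lt_rpow hA.le (by linarith) (by linarith)
  have h2 : B ^ (s - 1) < (A + B) ^ (s - 1) :=
    Real.rpow_lt_rpow hB.le (by linarith) (by linarith)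
  rw [h A hA, h B hB, h (A + B) (by linarith), add_mul]
  exact add_lt_add (mul_lt_mul_of_pos_left h1 hA) (mul_lt_mul_of_pos_left h2 hB)

lemma rpow_add_lt_add_rpow {A B s : ℝ} (hA : 0 < A) (hB : 0 < B) (hs : s < 1) :
    (A + B) ^ s < A ^ s + B ^ s := by
  have h : ∀ x : ℝ, 0 < x → x ^ s = x * x ^ (s - 1) := fun x hx => by
    rw [Real.rpow_sub_one hx.ne', mul_div_cancel₀ _ hx.ne']
  have h1 : (A + B) ^ (s - 1) < A ^ (s - 1) :=
    Real.rpow_lt_rpow_of_neg hA (by linarith) (by linarith)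
  have h2 : (A + B) ^ (s - 1) < B ^ (s - 1) :=
    Real.rpow_lt_rpow_of_neg hB (by linarith) (by linarith)
  rw [h A hA, h B hB, h (A + B) (by linarith), add_mul]
  exact add_lt_add (mul_lt_mul_of_pos_left h1 hA) (mul_lt_mul_of_pos_left h2 hB)

/-- The defect of the parallelogram law in the exponent `p`. -/
def parallelogramDefect (p : ℝ) (a b : ℂ) : ℝ :=
  ‖a + b‖ ^ p + ‖a - b‖ ^ p - 2 * (‖a‖ ^ p + ‖b‖ ^ p)

lemma parallelogramDefect_eq_zero {p : ℝ} (hp : 0 < p) {a b : ℂ} (h : a = 0 ∨ b = 0) :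
    parallelogramDefect p a b = 0 := by
  rcases h with rfl | rfl
  · simp [parallelogramDefect, Real.zero_rpow hp.ne']
    ring
  · simp [parallelogramDefect, Real.zero_rpow hp.ne']
    ring

lemma norm_rpow_eq_sq_rpow_half (p : ℝ) (a : ℂ) : ‖a‖ ^ p = (‖a‖ ^ 2) ^ (p / 2) := by
  rw [← Real.rpow_natCast, ← Real.rpow_mul (norm_nonneg _)]
  congr 1
  push_cast
  ring

lemma parallelogram_norm_sq (a b : ℂ) :
    ‖a + b‖ ^ 2 + ‖a - b‖ ^ 2 = 2 * (‖a‖ ^ 2 + ‖b‖ ^ 2) := by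
  have := parallelogram_law_with_norm ℝ a b
  linarith

lemma parallelogramDefect_pos {p : ℝ} (hp : 2 < p) {a b : ℂ} (ha : a ≠ 0) (hb : b ≠ 0) :
    0 < parallelogramDefect p a b := by
  have h1 := (convexOn_rpow (show 1 ≤ p / 2 by linarith)).2
    (Set.mem_Ici.2 (sq_nonneg ‖a + b‖))
    (Set.mem_Ici.2 (sq_nonneg ‖a - b‖))
    (show (0 : ℝ) ≤ 1 / 2 by norm_num) (show (0 : ℝ) ≤ 1 / 2 by norm_num) (by norm_num)
  simp only [smul_eq_mul] at h1
  rw [← mul_add, parallelogram_norm_sq, one_div, inv_mul_cancel_left₀ two_ne_zero] at h1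
  have h2 := add_rpow_lt_rpow_add (pow_pos (norm_pos_iff.2 ha) 2) (pow_pos (norm_pos_iff.2 hb) 2)
    (show 1 < p / 2 by linarith)
  simp only [← norm_rpow_eq_sq_rpow_half] at h1 h2
  rw [parallelogramDefect]
  linarith

lemma parallelogramDefect_neg {p : ℝ} (hp0 : 0 < p) (hp : p < 2) {a b : ℂ} (ha : a ≠ 0)
    (hb : b ≠ 0) : parallelogramDefect p a b < 0 := by
  have h1 := (Real.concaveOn_rpow (show 0 ≤ p / 2 by linarith) (show p / 2 ≤ 1 by linarith)).2
    (Set.mem_Ici.2 (sq_nonneg ‖a + b‖))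
    (Set.mem_Ici.2 (sq_nonneg ‖a - b‖))
    (show (0 : ℝ) ≤ 1 / 2 by norm_num) (show (0 : ℝ) ≤ 1 / 2 by norm_num) (by norm_num)
  simp only [smul_eq_mul] at h1
  rw [← mul_add _ (‖a + b‖ ^ 2), parallelogram_norm_sq, one_div,
    inv_mul_cancel_left₀ two_ne_zero] at h1
  have h2 := rpow_add_lt_add_rpow (pow_pos (norm_pos_iff.2 ha) 2) (pow_pos (norm_pos_iff.2 hb) 2)
    (show p / 2 < 1 by linarith)
  simp only [← norm_rpow_eq_sq_rpow_half] at h1 h2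
  rw [parallelogramDefect]
  linarith

end Clarkson

section Disjoint

variable {X : Type v} [MeasurableSpace X] {ν : Measure X} {p r : ℝ≥0∞}
  [hp1 : Fact (1 ≤ p)] [hr1 : Fact (1 ≤ r)]

/-- The supports of `f` and `g` are disjoint up to a null set. -/
def LpDisjoint (f g : Lp ℂ p ν) : Prop := ∀ᵐ x ∂ν, f x = 0 ∨ g x = 0

lemma LpDisjoint.symm {f g : Lp ℂ p ν} (h : LpDisjoint f g) : LpDisjoint g f :=
  h.mono fun _ => Or.symm

lemma LpDisjoint.add_left {f f' g : Lp ℂ p ν} (h : LpDisjoint f g) (h' : LpDisjoint f' g) :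
    LpDisjoint (f + f') g := by
  filter_upwards [h, h', Lp.coeFn_add f f'] with x h1 h2 h3
  rw [h3, Pi.add_apply]
  rcases h1 with h1 | h1
  · rcases h2 with h2 | h2
    · exact Or.inl (by rw [h1, h2, add_zero])
    · exact Or.inr h2
  · exact Or.inr h1

lemma LpDisjoint.smul_left {f g : Lp ℂ p ν} (h : LpDisjoint f g) (c : ℂ) :
    LpDisjoint (c • f) g := by
  filter_upwards [h, Lp.coeFn_smul c f] with x h1 h3
  rw [h3, Pi.smul_apply]
  exact h1.imp_left fun h => by rw [h, smul_zero]

lemma LpDisjoint.sum_smul_left {κ : Type*} {s : Finset κ} {d : κ → Lp ℂ p ν} {g : Lp ℂ p ν}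
    (c : κ → ℂ) (h : ∀ i ∈ s, LpDisjoint (d i) g) : LpDisjoint (∑ i ∈ s, c i • d i) g := by
  classical
  induction s using Finset.induction_on with
  | empty =>
    rw [Finset.sum_empty]
    filter_upwards [Lp.coeFn_zero ℂ p ν] with x hx
    exact Or.inl (by rw [hx, Pi.zero_apply])
  | insert j s hj ih =>
    rw [Finset.sum_insert hj]
    exact ((h j (Finset.mem_insert_self _ _)).smul_left _).add_left
      (ih fun i hi => h i (Finset.mem_insert_of_mem hi))

lemma integral_parallelogramDefect (hp : p ≠ ∞) (f g : Lp ℂ p ν) :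
    Integrable (fun x => parallelogramDefect p.toReal (f x) (g x)) ν ∧
      ∫ x, parallelogramDefect p.toReal (f x) (g x) ∂ν =
        ‖f + g‖ ^ p.toReal + ‖f - g‖ ^ p.toReal - 2 * (‖f‖ ^ p.toReal + ‖g‖ ^ p.toReal) := by
  obtain ⟨e1, i1⟩ := Lp.norm_rpow_eq_integral_of_ae hp (f + g) (g := fun x => f x + g x)
    (Lp.coeFn_add f g)
  obtain ⟨e2, i2⟩ := Lp.norm_rpow_eq_integral_of_ae hp (f - g) (g := fun x => f x - g x)
    (Lp.coeFn_sub f g)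
  have i3 := Lp.integrable_norm_rpow hp f
  have i4 := Lp.integrable_norm_rpow hp g
  have i12 : Integrable (fun x => ‖f x + g x‖ ^ p.toReal + ‖f x - g x‖ ^ p.toReal) ν := i1.add i2
  have i34 : Integrable (fun x => ‖f x‖ ^ p.toReal + ‖g x‖ ^ p.toReal) ν := i3.add i4
  refine ⟨i12.sub (i34.const_mul 2), ?_⟩
  simp only [parallelogramDefect]
  rw [integral_sub i12 (i34.const_mul 2), integral_add i1 i2, integral_const_mul,
    integral_add i3 i4, e1, e2, Lp.norm_rpow_eq_integral hp f, Lp.norm_rpow_eq_integral hp g]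

/-- Disjointness of supports in `L_p`, `p ≠ 2`, is the case of equality in Clarkson's inequality
and hence is determined by norms. -/
lemma lpDisjoint_iff (hp : p ≠ ∞) (hp2 : p ≠ 2) (f g : Lp ℂ p ν) : LpDisjoint f g ↔
    ‖f + g‖ ^ p.toReal + ‖f - g‖ ^ p.toReal - 2 * (‖f‖ ^ p.toReal + ‖g‖ ^ p.toReal) = 0 := by
  have hP := toReal_pos_of_fact hp
  obtain ⟨hi, he⟩ := integral_parallelogramDefect hp f g
  rw [← he]
  have hP2 : p.toReal ≠ 2 := fun h => hp2 (by
    rw [← ENNReal.ofReal_toReal hp, h]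
    norm_num)
  constructor
  · intro h
    refine integral_eq_zero_of_ae ?_
    filter_upwards [h] with x hx
    exact parallelogramDefect_eq_zero hP hx
  · intro h0
    have hae : (fun x => parallelogramDefect p.toReal (f x) (g x)) =ᵐ[ν] 0 := by
      rcases lt_or_gt_of_ne hP2 with hlt | hgt
      · have hnn : 0 ≤ᵐ[ν] fun x => -parallelogramDefect p.toReal (f x) (g x) := by
          refine ae_of_all _ fun x => ?_
          by_cases hx : f x = 0 ∨ g x = 0
          · simp [parallelogramDefect_eq_zero hP hx]
          · rw [not_or] at hx
            simpa using (parallelogramDefect_neg hP hlt hx.1 hx.2).le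
        have := (integral_eq_zero_iff_of_nonneg_ae hnn hi.neg).1 (by rw [integral_neg, h0, neg_zero])
        filter_upwards [this] with x hx
        simpa using hx
      · rw [← integral_eq_zero_iff_of_nonneg_ae ?_ hi, h0]
        refine ae_of_all _ fun x => ?_
        by_cases hx : f x = 0 ∨ g x = 0
        · simp [parallelogramDefect_eq_zero hP hx]
        · rw [not_or] at hx
          exact (parallelogramDefect_pos hgt hx.1 hx.2).le
    filter_upwards [hae] with x hx
    by_contra hcon
    rw [not_or] at hcon
    have hx' : parallelogramDefect p.toReal (f x) (g x) = 0 := hx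
    rcases lt_or_gt_of_ne hP2 with hlt | hgt
    · exact (parallelogramDefect_neg hP hlt hcon.1 hcon.2).ne hx'
    · exact (parallelogramDefect_pos hgt hcon.1 hcon.2).ne' hx'

lemma LpDisjoint.map (hp : p ≠ ∞) (hp2 : p ≠ 2) (U : Lp ℂ p ν ≃ₗᵢ[ℂ] Lp ℂ p ν) {f g : Lp ℂ p ν}
    (h : LpDisjoint f g) : LpDisjoint (U f) (U g) := by
  rw [lpDisjoint_iff hp hp2] at h ⊢
  rwa [← map_add, ← map_sub, LinearIsometryEquiv.norm_map, LinearIsometryEquiv.norm_map,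
    LinearIsometryEquiv.norm_map, LinearIsometryEquiv.norm_map]

lemma mazur_add_of_disjoint (hp : p ≠ ∞) (hr : r ≠ ∞) {f g : Lp ℂ p ν} (h : LpDisjoint f g) :
    mazur hp hr (f + g) = mazur hp hr f + mazur hp hr g := by
  refine Lp.ext ?_
  filter_upwards [h, coeFn_mazur hp hr (f + g), coeFn_mazur hp hr f, coeFn_mazur hp hr g,
    Lp.coeFn_add f g, Lp.coeFn_add (mazur hp hr f) (mazur hp hr g)] with x h0 h1 h2 h3 h4 h5
  rw [h1, h4, h5, Pi.add_apply, Pi.add_apply, h2, h3]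
  rcases h0 with h0 | h0 <;> rw [h0] <;> simp [powSign_zero]

lemma mazur_zero (hp : p ≠ ∞) (hr : r ≠ ∞) : mazur hp hr (0 : Lp ℂ p ν) = 0 := by
  have := mazur_smul hp hr 0 (0 : Lp ℂ p ν)
  rwa [zero_smul, powSign_zero, zero_smul] at this

lemma mazur_sum_of_disjoint (hp : p ≠ ∞) (hr : r ≠ ∞) {κ : Type*} (s : Finset κ)
    {d : κ → Lp ℂ p ν} (hd : ∀ i j, i ≠ j → LpDisjoint (d i) (d j)) (c : κ → ℂ) :
    mazur hp hr (∑ i ∈ s, c i • d i) =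
      ∑ i ∈ s, powSign (p.toReal / r.toReal) (c i) • mazur hp hr (d i) := by
  classical
  induction s using Finset.induction_on with
  | empty => rw [Finset.sum_empty, Finset.sum_empty, mazur_zero]
  | insert j s hj ih =>
    rw [Finset.sum_insert hj, Finset.sum_insert hj, ← ih, ← mazur_smul]
    refine mazur_add_of_disjoint hp hr (LpDisjoint.smul_left (LpDisjoint.symm ?_) _)
    exact LpDisjoint.sum_smul_left c fun i hi => hd i j fun h => hj (h ▸ hi)

/-- A closed relation on `L_p` that holds for any two combinations of the same disjointly supported
functions holds everywhere, since two simple functions have a common partition. -/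
lemma Lp.induction_disjoint (hp : p ≠ ∞) {P : Lp ℂ p ν → Lp ℂ p ν → Prop}
    (hclosed : IsClosed {z : Lp ℂ p ν × Lp ℂ p ν | P z.1 z.2})
    (h : ∀ (s : Finset (ℂ × ℂ)) (d : ℂ × ℂ → Lp ℂ p ν) (a b : ℂ × ℂ → ℂ),
      (∀ i j, i ≠ j → LpDisjoint (d i) (d j)) → P (∑ i ∈ s, a i • d i) (∑ i ∈ s, b i • d i))
    (f g : Lp ℂ p ν) : P f g := by
  classical
  refine (Lp.simpleFunc.denseRange (E := ℂ) (μ := ν) hp).induction_on₂ hclosed (fun f g => ?_) f g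
  set f' := Lp.simpleFunc.toSimpleFunc f with hf'
  set g' := Lp.simpleFunc.toSimpleFunc g with hg'
  have hfL : MemLp f' p ν := Lp.simpleFunc.memLp f
  have hgL : MemLp g' p ν := Lp.simpleFunc.memLp g
  have hp0 : p ≠ 0 := (one_pos.trans_le hp1.out).ne'
  set S := f'.pair g' with hS
  have hfin : ∀ z : ℂ × ℂ, z ≠ 0 → ν (S ⁻¹' {z}) ≠ ∞ := fun z hz => by
    by_cases hz1 : z.1 = 0
    · have hz2 : z.2 ≠ 0 := fun h2 => hz (Prod.ext hz1 h2)
      refine ((measure_mono fun x hx => ?_).trans_lt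
        (SimpleFunc.measure_preimage_lt_top_of_memLp hp0 hp g' hgL z.2 hz2)).ne
      exact congrArg Prod.snd hx
    · refine ((measure_mono fun x hx => ?_).trans_lt
        (SimpleFunc.measure_preimage_lt_top_of_memLp hp0 hp f' hfL z.1 hz1)).ne
      exact congrArg Prod.fst hx
  -- Only the fibre over `0`, whose coefficients vanish, may have infinite measure.
  let d : ℂ × ℂ → Lp ℂ p ν := fun z =>
    if hz : ν (S ⁻¹' {z}) ≠ ∞ then indicatorConstLp p (S.measurableSet_fiber z) hz 1 else 0
  have hd0 : ∀ z, ∀ᵐ x ∂ν, S x ≠ z → d z x = 0 := fun z => by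
    by_cases hz : ν (S ⁻¹' {z}) ≠ ∞
    · simp only [d, dif_pos hz]
      filter_upwards [indicatorConstLp_coeFn_notMem (p := p) (hs := S.measurableSet_fiber z)
        (hμs := hz) (c := (1 : ℂ))] with x hx hxz
      exact hx hxz
    · simp only [d, dif_neg hz]
      filter_upwards [Lp.coeFn_zero ℂ p ν] with x hx _
      rw [hx, Pi.zero_apply]
  have hd1 : ∀ z, z ≠ 0 → ∀ᵐ x ∂ν, S x = z → d z x = 1 := fun z hz => by
    simp only [d, dif_pos (hfin z hz)]
    filter_upwards [indicatorConstLp_coeFn_mem (p := p) (hs := S.measurableSet_fiber z)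
      (hμs := hfin z hz) (c := (1 : ℂ))] with x hx hxz
    exact hx hxz
  have hdisj : ∀ i j, i ≠ j → LpDisjoint (d i) (d j) := fun i j hij => by
    filter_upwards [hd0 i, hd0 j] with x h1 h2
    by_cases hx : S x = i
    · exact Or.inr (h2 fun h => hij (hx.symm.trans h))
    · exact Or.inl (h1 hx)
  have hsum : ∀ (c : ℂ × ℂ → ℂ), c 0 = 0 → ∀ φ : Lp ℂ p ν, (φ =ᵐ[ν] fun x => c (S x)) →
      φ = ∑ z ∈ S.range, c z • d z := fun c hc φ hφ => by
    refine Lp.ext ?_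
    have h0 : ∀ᵐ x ∂ν, ∀ z ∈ S.range, S x ≠ z → d z x = 0 :=
      (ae_ball_iff S.range.countable_toSet).2 fun z _ => hd0 z
    have h1 : ∀ᵐ x ∂ν, ∀ z ∈ S.range, z ≠ 0 → S x = z → d z x = 1 :=
      (ae_ball_iff S.range.countable_toSet).2 fun z _ => by
        by_cases hz : z = 0
        · exact ae_of_all _ fun x h => absurd hz h
        · exact (hd1 z hz).mono fun x hx _ => hx
    have h2 : ∀ᵐ x ∂ν, ∀ z ∈ S.range, (c z • d z : Lp ℂ p ν) x = c z * d z x :=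
      (ae_ball_iff S.range.countable_toSet).2 fun z _ => Lp.coeFn_smul (c z) (d z)
    filter_upwards [hφ, h0, h1, h2,
      Lp.coeFn_fun_finsetSum S.range fun z => c z • d z] with x hx hx0 hx1 hx2 hx3
    rw [hx, hx3, Finset.sum_eq_single_of_mem (S x) (S.mem_range_self x)]
    · rw [hx2 _ (S.mem_range_self x)]
      by_cases hz : S x = 0
      · rw [hz, hc, zero_mul]
      · rw [hx1 _ (S.mem_range_self x) hz rfl, mul_one]
    · intro z hz hne
      rw [hx2 z hz, hx0 z hz hne.symm, mul_zero]
  rw [hsum Prod.fst rfl f (Lp.simpleFunc.toSimpleFunc_eq_toFun f).symm,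
    hsum Prod.snd rfl g (Lp.simpleFunc.toSimpleFunc_eq_toFun g).symm]
  exact h _ _ _ _ hdisj

/-- The conjugate of an isometry of `L_p` by a Mazur map is additive: on disjointly supported
functions both Mazur maps act on the coefficients only. -/
theorem mazur_conj_add (hp : p ≠ ∞) (hr : r ≠ ∞) (hp2 : p ≠ 2)
    (U : Lp ℂ p ν ≃ₗᵢ[ℂ] Lp ℂ p ν) (f g : Lp ℂ r ν) :
    mazur hp hr (U (mazur hr hp (f + g))) =
      mazur hp hr (U (mazur hr hp f)) + mazur hp hr (U (mazur hr hp g)) := by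
  have hP := toReal_pos_of_fact hp
  have hR := toReal_pos_of_fact hr
  have key : ∀ f g : Lp ℂ p ν, mazur hp hr (U (mazur hr hp (mazur hp hr f + mazur hp hr g))) =
      mazur hp hr (U f) + mazur hp hr (U g) := by
    refine Lp.induction_disjoint hp ?_ ?_
    · have c1 := continuous_mazur hp hr (ν := ν)
      have c2 := continuous_mazur hr hp (ν := ν)
      have c3 := U.continuous
      exact isClosed_eq (c1.comp (c3.comp (c2.comp ((c1.comp continuous_fst).add
        (c1.comp continuous_snd))))) ((c1.comp (c3.comp continuous_fst)).add
          (c1.comp (c3.comp continuous_snd)))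
    · intro s d a b hd
      set θ := p.toReal / r.toReal with hθ
      set c : ℂ × ℂ → ℂ := fun i => powSign (r.toReal / p.toReal) (powSign θ (a i) + powSign θ (b i))
        with hc
      have hθc : ∀ i, powSign θ (c i) = powSign θ (a i) + powSign θ (b i) := fun i => by
        rw [hc, powSign_powSign (div_pos hR hP), hθ, div_mul_div_cancel₀ hP.ne', div_self hR.ne',
          powSign_one]
      have hUd : ∀ i j, i ≠ j → LpDisjoint (U (d i)) (U (d j)) := fun i j hij =>
        (hd i j hij).map hp hp2 U
      have e1 : mazur hp hr (∑ i ∈ s, a i • d i) + mazur hp hr (∑ i ∈ s, b i • d i) =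
          mazur hp hr (∑ i ∈ s, c i • d i) := by
        rw [mazur_sum_of_disjoint hp hr s hd, mazur_sum_of_disjoint hp hr s hd,
          mazur_sum_of_disjoint hp hr s hd, ← Finset.sum_add_distrib]
        simp only [← hθ, hθc, add_smul]
      rw [e1, mazur_mazur, map_sum, map_sum, map_sum]
      simp only [map_smul]
      rw [mazur_sum_of_disjoint hp hr s hUd, mazur_sum_of_disjoint hp hr s hUd,
        mazur_sum_of_disjoint hp hr s hUd, ← Finset.sum_add_distrib]
      simp only [← hθ, hθc, add_smul]
  have := key (mazur hr hp f) (mazur hr hp g)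
  rwa [mazur_mazur, mazur_mazur] at this

lemma mazur_conj_smul (hp : p ≠ ∞) (hr : r ≠ ∞) (U : Lp ℂ p ν ≃ₗᵢ[ℂ] Lp ℂ p ν) (c : ℂ)
    (f : Lp ℂ r ν) :
    mazur hp hr (U (mazur hr hp (c • f))) = c • mazur hp hr (U (mazur hr hp f)) := by
  have hP := toReal_pos_of_fact hp
  have hR := toReal_pos_of_fact hr
  rw [mazur_smul, map_smul, mazur_smul, powSign_powSign (div_pos hR hP),
    div_mul_div_cancel₀ hP.ne', div_self hR.ne', powSign_one]

lemma norm_mazur_conj (hp : p ≠ ∞) (hr : r ≠ ∞) (U : Lp ℂ p ν ≃ₗᵢ[ℂ] Lp ℂ p ν) (f : Lp ℂ r ν) :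
    ‖mazur hp hr (U (mazur hr hp f))‖ = ‖f‖ := by
  have hR := toReal_pos_of_fact hr
  have h : ‖mazur hp hr (U (mazur hr hp f))‖ ^ r.toReal = ‖f‖ ^ r.toReal := by
    rw [norm_mazur_rpow, LinearIsometryEquiv.norm_map, norm_mazur_rpow]
  exact (Real.rpow_left_inj (norm_nonneg _) (norm_nonneg _) hR.ne').1 h

end Disjoint

/-! ### The duality map of `L_p` -/

section Duality

variable {X : Type v} [MeasurableSpace X] {ν : Measure X} {p q : ℝ≥0∞}
  [hp1 : Fact (1 ≤ p)] [hq1 : Fact (1 ≤ q)]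

variable (ν q) in
/-- Pointwise complex conjugation on `L_q`. -/
def lpConj : Lp ℂ q ν →L[ℝ] Lp ℂ q ν :=
  (Complex.conjCLE : ℂ →L[ℝ] ℂ).compLpL q ν

lemma coeFn_lpConj (f : Lp ℂ q ν) : lpConj ν q f =ᵐ[ν] fun x => starRingEnd ℂ (f x) :=
  ContinuousLinearMap.coeFn_compLpL _ f

lemma lpConj_smul (c : ℂ) (f : Lp ℂ q ν) :
    lpConj ν q (c • f) = starRingEnd ℂ c • lpConj ν q f := by
  refine Lp.ext ?_
  filter_upwards [coeFn_lpConj (c • f), coeFn_lpConj f, Lp.coeFn_smul c f,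
    Lp.coeFn_smul (starRingEnd ℂ c) (lpConj ν q f)] with x h1 h2 h3 h4
  rw [h1, h3, h4, Pi.smul_apply, Pi.smul_apply, h2, smul_eq_mul, smul_eq_mul, map_mul]

lemma norm_lpConj (f : Lp ℂ q ν) : ‖lpConj ν q f‖ = ‖f‖ := by
  refine le_antisymm (Lp.norm_le_norm_of_ae_le ?_) (Lp.norm_le_norm_of_ae_le ?_) <;>
  · filter_upwards [coeFn_lpConj f] with x hx
    rw [hx, RCLike.norm_conj]

variable [hpq : ENNReal.HolderConjugate q p]

/-- The functional `x ↦ ∫ conj(u) |u|^(p-2) x` on `L_p`, a multiple of the norming functional of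
`u`. -/
def dualityMap (hp : p ≠ ∞) (hq : q ≠ ∞) (u : Lp ℂ p ν) : Lp ℂ p ν →L[ℂ] ℂ :=
  (ContinuousLinearMap.mul ℂ ℂ).lpPairing ν q p (lpConj ν q (mazur hp hq u))

variable (hp : p ≠ ∞) (hq : q ≠ ∞)

lemma dualityMap_apply (u x : Lp ℂ p ν) : dualityMap hp hq u x =
    ∫ t, starRingEnd ℂ (powSign (p.toReal / q.toReal) (u t)) * x t ∂ν := by
  rw [dualityMap, ContinuousLinearMap.lpPairing_eq_integral]
  refine integral_congr_ae ?_
  filter_upwards [coeFn_lpConj (mazur hp hq u), coeFn_mazur hp hq u] with t h1 h2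
  rw [ContinuousLinearMap.mul_apply', h1, h2]

include hpq hp1 hq1 in
lemma HolderConjugate.toReal_div_toReal (hp : p ≠ ∞) (hq : q ≠ ∞) :
    p.toReal / q.toReal = p.toReal - 1 :=
  (ENNReal.HolderConjugate.toReal_of_ne_top hq hp (p := q) (q := p)).symm.div_conj_eq_sub_one

lemma dualityMap_self (u : Lp ℂ p ν) : dualityMap hp hq u u = ((‖u‖ ^ p.toReal : ℝ) : ℂ) := by
  rw [dualityMap_apply, Lp.norm_rpow_eq_integral hp, ← integral_complex_ofReal]
  refine integral_congr_ae (ae_of_all _ fun t => ?_)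
  change starRingEnd ℂ (powSign (p.toReal / q.toReal) (u t)) * u t = ((‖u t‖ ^ p.toReal : ℝ) : ℂ)
  rcases eq_or_ne (u t) 0 with h0 | h0
  · rw [h0, mul_zero, norm_zero, Real.zero_rpow (toReal_pos_of_fact hp).ne', Complex.ofReal_zero]
  · have hn : ‖u t‖ ≠ 0 := norm_ne_zero_iff.2 h0
    rw [powSign, map_mul, Complex.conj_ofReal, mul_assoc, mul_comm (starRingEnd ℂ (u t)),
      Complex.mul_conj, Complex.normSq_eq_norm_sq, ← Complex.ofReal_mul,
      HolderConjugate.toReal_div_toReal hp hq, Real.rpow_sub_one hn, Real.rpow_sub_one hn]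
    congr 1
    field_simp

lemma norm_dualityMap_apply_le (u x : Lp ℂ p ν) :
    ‖dualityMap hp hq u x‖ ≤ ‖u‖ ^ (p.toReal - 1) * ‖x‖ := by
  have hQ := toReal_pos_of_fact hq
  set ψ := lpConj ν q (mazur hp hq u) with hψ
  have h1 : ‖dualityMap hp hq u x‖ ≤ ‖(ContinuousLinearMap.mul ℂ ℂ).holder 1 ψ x‖ := by
    rw [dualityMap, ContinuousLinearMap.lpPairing_eq_integral, L1.norm_eq_integral_norm]
    refine (norm_integral_le_integral_norm _).trans (le_of_eq (integral_congr_ae ?_))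
    filter_upwards [(ContinuousLinearMap.mul ℂ ℂ).coeFn_holder (r := 1) ψ x] with t ht
    rw [ht]
  have h2 := (ContinuousLinearMap.mul ℂ ℂ).norm_holder_apply_apply_le (r := 1) ψ x
  have h3 : ‖ψ‖ = ‖u‖ ^ (p.toReal - 1) := by
    rw [hψ, norm_lpConj, ← HolderConjugate.toReal_div_toReal hp hq, div_eq_mul_inv,
      Real.rpow_mul (norm_nonneg _), ← norm_mazur_rpow hp hq, Real.rpow_rpow_inv (norm_nonneg _)
      hQ.ne']
  rw [h3] at h2
  refine h1.trans (h2.trans ?_)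
  have h4 := ContinuousLinearMap.opNorm_mul_le ℂ ℂ
  have h5 : 0 ≤ ‖u‖ ^ (p.toReal - 1) := by positivity
  exact mul_le_mul_of_nonneg_right (mul_le_of_le_one_left h5 h4) (norm_nonneg _)

lemma continuous_dualityMap : Continuous (dualityMap hp hq : Lp ℂ p ν → Lp ℂ p ν →L[ℂ] ℂ) :=
  ((ContinuousLinearMap.mul ℂ ℂ).lpPairing ν q p).continuous.comp
    ((lpConj ν q).continuous.comp (continuous_mazur hp hq))

lemma dualityMap_sum {κ : Type*} (s : Finset κ) {d : κ → Lp ℂ p ν}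
    (hd : ∀ i j, i ≠ j → LpDisjoint (d i) (d j)) (a b : κ → ℂ) :
    dualityMap hp hq (∑ i ∈ s, a i • d i) (∑ i ∈ s, b i • d i) =
      ∑ i ∈ s, starRingEnd ℂ (powSign (p.toReal / q.toReal) (a i)) * b i *
        ((‖d i‖ ^ p.toReal : ℝ) : ℂ) := by
  have h1 : ∀ x, dualityMap hp hq (∑ i ∈ s, a i • d i) x =
      ∑ i ∈ s, starRingEnd ℂ (powSign (p.toReal / q.toReal) (a i)) * dualityMap hp hq (d i) x := by
    intro x
    rw [dualityMap, mazur_sum_of_disjoint hp hq s hd, map_sum, map_sum]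
    simp only [lpConj_smul, map_smul, sum_apply, smul_apply, smul_eq_mul]
    rfl
  rw [h1]
  refine Finset.sum_congr rfl fun i hi => ?_
  rw [map_sum, Finset.sum_eq_single_of_mem i hi, map_smul, dualityMap_self, smul_eq_mul, mul_assoc]
  intro j hj hne
  rw [map_smul, smul_eq_mul, dualityMap_apply]
  refine mul_eq_zero_of_right _ (integral_eq_zero_of_ae ?_)
  filter_upwards [hd i j hne.symm] with t ht
  rcases ht with ht | ht <;> rw [ht] <;> simp [powSign_zero]

/-- Isometries of `L_p` preserve the duality map. For `p = 2` it is the inner product. -/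
theorem dualityMap_map (U : Lp ℂ p ν ≃ₗᵢ[ℂ] Lp ℂ p ν) (u x : Lp ℂ p ν) :
    dualityMap hp hq (U u) (U x) = dualityMap hp hq u x := by
  rcases eq_or_ne p 2 with rfl | hp2
  · have h : ∀ u x : Lp ℂ 2 ν, dualityMap hp hq u x = inner ℂ u x := fun u x => by
      rw [dualityMap_apply, L2.inner_def, HolderConjugate.toReal_div_toReal hp hq]
      refine integral_congr_ae (ae_of_all _ fun t => ?_)
      change starRingEnd ℂ (powSign (ENNReal.toReal 2 - 1) (u t)) * x t = inner ℂ (u t) (x t)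
      rw [ENNReal.toReal_ofNat, show (2 : ℝ) - 1 = 1 by norm_num, powSign_one, RCLike.inner_apply,
        mul_comm]
    rw [h, h, LinearIsometryEquiv.inner_map_map]
  revert u x
  refine Lp.induction_disjoint hp ?_ ?_
  · have c := continuous_dualityMap hp hq (ν := ν)
    exact isClosed_eq ((c.comp (U.continuous.comp continuous_fst)).clm_apply
      (U.continuous.comp continuous_snd)) ((c.comp continuous_fst).clm_apply continuous_snd)
  · intro s d a b hd
    rw [map_sum, map_sum]
    simp only [map_smul]
    rw [dualityMap_sum hp hq s (fun i j hij => (hd i j hij).map hp hp2 U),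
      dualityMap_sum hp hq s hd]
    simp only [LinearIsometryEquiv.norm_map]

end Duality

/-! ### Property (T) for Hilbert spaces in an arbitrary universe -/

namespace IsometricRep

section Constructions

variable {G : Type u} [Group G] [TopologicalSpace G]

/-- An isometric representation from an action by linear norm-preserving maps. -/
def ofAction {E : Type v} [NormedAddCommGroup E] [NormedSpace ℂ E] (a : G → E → E)
    (hadd : ∀ g v w, a g (v + w) = a g v + a g w) (hsmul : ∀ g (c : ℂ) v, a g (c • v) = c • a g v)
    (hnorm : ∀ g v, ‖a g v‖ = ‖v‖) (hone : ∀ v, a 1 v = v)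
    (hmul : ∀ g h v, a (g * h) v = a g (a h v)) (hcont : ∀ v, Continuous fun g => a g v) :
    IsometricRep G E where
  toHom :=
    { toFun := fun g =>
        { toFun := a g
          invFun := a g⁻¹
          map_add' := hadd g
          map_smul' := hsmul g
          left_inv := fun v => by rw [← hmul, inv_mul_cancel, hone]
          right_inv := fun v => by rw [← hmul, mul_inv_cancel, hone]
          norm_map' := hnorm g }
      map_one' := by
        ext v
        exact hone v
      map_mul' := fun g h => by
        ext v
        exact hmul g h v }
  continuous_orbit := hcont

lemma one_apply' {E : Type v} [NormedAddCommGroup E] [NormedSpace ℂ E] (π : IsometricRep G E)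
    (v : E) : π 1 v = v := by
  rw [map_one]
  rfl

lemma mul_apply' {E : Type v} [NormedAddCommGroup E] [NormedSpace ℂ E] (π : IsometricRep G E)
    (g h : G) (v : E) : π (g * h) v = π g (π h v) := by
  rw [map_mul]
  rfl

/-- The representation on an invariant subspace `S`, carried over to a space `K` by an
isometry `e : S ≃ K`. -/
def restrictTransport {H : Type v} [NormedAddCommGroup H] [NormedSpace ℂ H] {K : Type w}
    [NormedAddCommGroup K] [NormedSpace ℂ K] (π : IsometricRep G H) (S : Submodule ℂ H)
    (hS : ∀ g, ∀ x ∈ S, π g x ∈ S) (e : S ≃ₗᵢ[ℂ] K) : IsometricRep G K :=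
  ofAction (fun g k => e ⟨π g (e.symm k), hS g _ (e.symm k).2⟩)
    (fun g v w => by
      rw [← map_add]
      congr 1
      exact Subtype.ext (by simp))
    (fun g c v => by
      rw [← map_smul]
      congr 1
      exact Subtype.ext (by simp))
    (fun g v => by
      rw [LinearIsometryEquiv.norm_map]
      change ‖π g (e.symm v)‖ = ‖v‖
      rw [LinearIsometryEquiv.norm_map, Submodule.norm_coe, LinearIsometryEquiv.norm_map])
    (fun v => by simp)
    (fun g h v => by simp)
    (fun v => e.continuous.comp ((π.continuous_orbit _).subtype_mk _))

lemma restrictTransport_apply {H : Type v} [NormedAddCommGroup H] [NormedSpace ℂ H] {K : Type w}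
    [NormedAddCommGroup K] [NormedSpace ℂ K] (π : IsometricRep G H) (S : Submodule ℂ H)
    (hS : ∀ g, ∀ x ∈ S, π g x ∈ S) (e : S ≃ₗᵢ[ℂ] K) (g : G) (k : K) :
    π.restrictTransport S hS e g k = e ⟨π g (e.symm k), hS g _ (e.symm k).2⟩ := rfl

end Constructions

end IsometricRep

/-- A Hilbert space that is small for a universe is isometric to a Hilbert space in it. -/
lemma exists_linearIsometryEquiv_of_small (S : Type v) [NormedAddCommGroup S]
    [InnerProductSpace ℂ S] [CompleteSpace S] [Small.{u} S] :
    ∃ (K : Type u) (_ : NormedAddCommGroup K) (_ : InnerProductSpace ℂ K) (_ : CompleteSpace K),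
      Nonempty (S ≃ₗᵢ[ℂ] K) := by
  let e : Shrink.{u} S ≃ₗ[ℂ] S := Shrink.linearEquiv ℂ S
  have he : ∀ x, ‖e x‖ = ‖x‖ := fun x => rfl
  let : InnerProductSpace ℂ (Shrink.{u} S) :=
    { (inferInstance : NormedSpace ℂ (Shrink.{u} S)) with
      inner := fun x y => inner ℂ (e x) (e y)
      norm_sq_eq_re_inner := fun x => by
        rw [← he]
        exact norm_sq_eq_re_inner (e x)
      conj_inner_symm := fun x y => inner_conj_symm (e x) (e y)
      add_left := fun x y z => by
        rw [map_add]
        exact inner_add_left _ _ _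
      smul_left := fun x y r => by
        rw [map_smul]
        exact inner_smul_left _ _ _ }
  let i : Shrink.{u} S ≃ₗᵢ[ℂ] S := { e with norm_map' := he }
  exact ⟨Shrink.{u} S, inferInstance, inferInstance,
    (completeSpace_congr i.isometry.isUniformEmbedding).2 inferInstance, ⟨i.symm⟩⟩

section PropertyT

variable {G : Type u} [Group G] [TopologicalSpace G] {H : Type v} [NormedAddCommGroup H]
  [InnerProductSpace ℂ H] [CompleteSpace H] (π : IsometricRep G H)

/-- The closed linear span of the orbit of `v`. -/
def cyclicSubspace (v : H) : Submodule ℂ H :=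
  (Submodule.span ℂ (Set.range fun g => π g v)).topologicalClosure

/-- A cyclic subspace consists of limits of sequences of finite linear combinations of an orbit of
`G`, so its cardinality is bounded in the universe of `G`. -/
instance small_cyclicSubspace (v : H) : Small.{u} (cyclicSubspace π v) := by
  have h : ∀ x : cyclicSubspace π v, ∃ c : ℕ → (G →₀ ℂ),
      Tendsto (fun n => Finsupp.linearCombination ℂ (fun g => π g v) (c n)) atTop (𝓝 (x : H)) := by
    intro x
    have hx : (x : H) ∈ closure (Submodule.span ℂ (Set.range fun g => π g v) : Set H) := x.2
    obtain ⟨y, hy, hlim⟩ := mem_closure_iff_seq_limit.1 hx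
    have : ∀ n, ∃ c : G →₀ ℂ, Finsupp.linearCombination ℂ (fun g => π g v) c = y n := fun n =>
      (Finsupp.mem_span_range_iff_exists_finsupp (R := ℂ) (v := fun g => π g v)).1 (hy n)
    choose c hc using this
    exact ⟨c, by simpa only [hc] using hlim⟩
  choose c hc using h
  refine small_of_injective (f := c) fun x y hxy => Subtype.ext ?_
  have := hc x
  rw [hxy] at this
  exact tendsto_nhds_unique this (hc y)

lemma apply_mem_cyclicSubspace (v : H) (g : G) (x : H) (hx : x ∈ cyclicSubspace π v) :
    π g x ∈ cyclicSubspace π v := by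
  have hmaps : Set.MapsTo (π g) (Submodule.span ℂ (Set.range fun g => π g v) : Set H)
      (Submodule.span ℂ (Set.range fun g => π g v) : Set H) := by
    intro y hy
    refine Submodule.span_induction (p := fun y _ =>
      π g y ∈ Submodule.span ℂ (Set.range fun g => π g v)) ?_ ?_ ?_ ?_ hy
    · rintro _ ⟨h, rfl⟩
      refine Submodule.subset_span ⟨g * h, ?_⟩
      exact π.mul_apply' g h v
    · rw [map_zero]
      exact zero_mem _
    · intro a b _ _ ha hb
      rw [map_add]
      exact add_mem ha hb
    · intro r a _ ha
      rw [map_smul]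
      exact Submodule.smul_mem _ _ ha
  exact map_mem_closure (π g).continuous hx hmaps

lemma self_mem_cyclicSubspace (v : H) : v ∈ cyclicSubspace π v :=
  Submodule.le_topologicalClosure _ (Submodule.subset_span ⟨1, π.one_apply' v⟩)

/-- The defining condition of property (T) for the pair `(Q, ε)`, restricted to Hilbert spaces in
the universe of `G`. -/
def IsPropertyTPair (G : Type u) [Group G] [TopologicalSpace G] (Q : Set G) (ε : ℝ) : Prop :=
  ∀ (H : Type u) [NormedAddCommGroup H] [InnerProductSpace ℂ H] [CompleteSpace H]
    (π : IsometricRep G H),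
    (∃ v : H, v ≠ 0 ∧ ∀ s ∈ Q, ‖π s v - v‖ < ε * ‖v‖) → ∃ w : H, w ≠ 0 ∧ ∀ g : G, π g w = w

variable {Q : Set G} {ε : ℝ}

lemma IsPropertyTPair.exists_fixed_mem_cyclicSubspace (hT : IsPropertyTPair G Q ε) {v : H}
    (hv : v ≠ 0) (h : ∀ s ∈ Q, ‖π s v - v‖ < ε * ‖v‖) :
    ∃ w ∈ cyclicSubspace π v, w ≠ 0 ∧ ∀ g, π g w = w := by
  have : CompleteSpace (cyclicSubspace π v) :=
    (Submodule.isClosed_topologicalClosure _).completeSpace_coe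
  obtain ⟨K, _, _, _, ⟨e⟩⟩ := exists_linearIsometryEquiv_of_small.{u} (cyclicSubspace π v)
  set σ := π.restrictTransport _ (apply_mem_cyclicSubspace π v) e with hσ
  have hσapp : ∀ g k, (e.symm (σ g k) : H) = π g (e.symm k) := fun g k => by
    rw [hσ, IsometricRep.restrictTransport_apply, LinearIsometryEquiv.symm_apply_apply]
  have hnorm : ∀ k : K, ‖k‖ = ‖(e.symm k : H)‖ := fun k => (e.symm.norm_map k).symm
  obtain ⟨k, hk0, hk⟩ := hT K σ ⟨e ⟨v, self_mem_cyclicSubspace π v⟩, by simpa using hv,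
    fun s hs => by
      rw [hnorm, hnorm, map_sub, Submodule.coe_sub, hσapp, LinearIsometryEquiv.symm_apply_apply]
      exact h s hs⟩
  refine ⟨e.symm k, (e.symm k).2, by simpa using hk0, fun g => ?_⟩
  rw [← hσapp, hk]

/-- In a group with property (T), almost invariant vectors are close to invariant vectors. -/
lemma IsPropertyTPair.exists_mem_fixed_norm_sub_le (hT : IsPropertyTPair G Q ε) {w : H} {c : ℝ}
    (hε : 0 < ε) (hc : 0 ≤ c) (h : ∀ s ∈ Q, ‖π s w - w‖ < ε * c) :
    ∃ x ∈ π.fixed, ‖w - x‖ ≤ c := by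
  have : CompleteSpace π.fixed := π.isClosed_fixed.completeSpace_coe
  obtain ⟨x, hx, y, hy, hxy⟩ := π.fixed.exists_add_mem_mem_orthogonal w
  refine ⟨x, hx, ?_⟩
  by_contra! hcon
  have hy' : w - x = y := by rw [hxy, add_sub_cancel_left]
  rw [hy'] at hcon
  have hy0 : y ≠ 0 := norm_pos_iff.1 (hc.trans_lt hcon)
  have horb : ∀ g, π g y ∈ π.fixedᗮ := fun g => by
    rw [Submodule.mem_orthogonal]
    intro u hu
    have : inner ℂ (π g u) (π g y) = inner ℂ u y := LinearIsometryEquiv.inner_map_map _ _ _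
    rw [hu g] at this
    rw [this]
    exact (Submodule.mem_orthogonal _ _).1 hy u hu
  have hsub : cyclicSubspace π y ≤ π.fixedᗮ := by
    refine Submodule.topologicalClosure_minimal _ (Submodule.span_le.2 ?_)
      (Submodule.isClosed_orthogonal _)
    rintro _ ⟨g, rfl⟩
    exact horb g
  obtain ⟨z, hz, hz0, hzf⟩ := hT.exists_fixed_mem_cyclicSubspace π hy0 fun s hs => by
    have e : π s y - y = π s w - w := by
      rw [hxy, map_add, hx s]
      abel
    rw [e]
    exact (h s hs).trans (mul_lt_mul_of_pos_left hcon hε)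
  exact hz0 (inner_self_eq_zero.1 ((Submodule.mem_orthogonal _ _).1 (hsub hz) z hzf))

end PropertyT

/-! ### Spectral gap of the family of all `L_p`-representations -/

section LpGap

variable {G : Type u} [Group G] [TopologicalSpace G] {X : Type v} [MeasurableSpace X]
  {ν : Measure X} {p : ℝ≥0∞} [hp1 : Fact (1 ≤ p)]

/-- The unitary representation on `L_2` obtained from an isometric representation on `L_p` by
conjugation with the Mazur map. -/
def IsometricRep.mazurConj (hp : p ≠ ∞) (π : IsometricRep G (Lp ℂ p ν)) :
    IsometricRep G (Lp ℂ 2 ν) :=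
  ofAction (fun g w => mazur hp ENNReal.ofNat_ne_top (π g (mazur ENNReal.ofNat_ne_top hp w)))
    (fun g v w => by
      rcases eq_or_ne p 2 with rfl | hp2
      · have h : ∀ f : Lp ℂ 2 ν, mazur hp hp f = f := fun f => by
          have := mazur_mazur hp hp f
          refine Lp.ext ?_
          filter_upwards [coeFn_mazur hp hp f] with x hx
          rw [hx, div_self (toReal_pos_of_fact hp).ne', powSign_one]
        simp only [h, map_add]
      · exact mazur_conj_add hp _ hp2 (π g) v w)
    (fun g c v => mazur_conj_smul hp _ (π g) c v)
    (fun g v => norm_mazur_conj hp _ (π g) v)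
    (fun v => by rw [π.one_apply', mazur_mazur])
    (fun g h v => by rw [mazur_mazur, π.mul_apply'])
    (fun v => (continuous_mazur hp _).comp (π.continuous_orbit _))

lemma IsometricRep.mazurConj_apply (hp : p ≠ ∞) (π : IsometricRep G (Lp ℂ p ν)) (g : G)
    (w : Lp ℂ 2 ν) : π.mazurConj hp g w =
      mazur hp ENNReal.ofNat_ne_top (π g (mazur ENNReal.ofNat_ne_top hp w)) := rfl

/-- A fixed vector `u` is normed by an invariant functional, which vanishes on `E_π`. -/
lemma IsometricRep.norm_le_norm_sub_of_mem_fixed (h1p : 1 < p) (hp : p ≠ ∞)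
    (π : IsometricRep G (Lp ℂ p ν)) {u v : Lp ℂ p ν} (hu : u ∈ π.fixed) (hv : v ∈ π.compl) :
    ‖u‖ ≤ ‖u - v‖ := by
  rcases eq_or_ne u 0 with rfl | hu0
  · simp
  have hq : p.conjExponent ≠ ∞ :=
    ENNReal.add_ne_top.2 ⟨ENNReal.one_ne_top, ENNReal.inv_ne_top.2 (tsub_pos_of_lt h1p).ne'⟩
  have hq1 : Fact (1 ≤ p.conjExponent) := ⟨le_self_add⟩
  have : ENNReal.HolderConjugate p.conjExponent p := ENNReal.HolderConjugate.symm
  have hinv : ∀ g x, dualityMap hp hq u (π g x) = dualityMap hp hq u x := fun g x => by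
    conv_lhs => rw [← hu g]
    exact dualityMap_map hp hq (π g) u x
  have h1 := norm_dualityMap_apply_le hp hq u (u - v)
  rw [map_sub, π.mem_compl_iff.1 hv _ hinv, sub_zero, dualityMap_self, Complex.norm_real,
    Real.norm_of_nonneg (by positivity)] at h1
  have hn : 0 < ‖u‖ := norm_pos_iff.2 hu0
  have h2 : ‖u‖ ^ p.toReal = ‖u‖ ^ (p.toReal - 1) * ‖u‖ := by
    rw [Real.rpow_sub_one hn.ne', div_mul_cancel₀ _ hn.ne']
  rw [h2] at h1
  exact le_of_mul_le_mul_left h1 (Real.rpow_pos_of_pos hn _)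

/-- Property (T) gives a common Kazhdan pair for all isometric representations on `L_p`-spaces: the
Mazur map turns an almost invariant unit vector of `E_π` into one of a unitary representation,
which is close to an invariant vector; the latter comes from a vector of `E^π`, and these are at
distance at least `1 / 2` from the unit sphere of `E_π`. -/
theorem HasPropertyT.hasSpectralGap_allLp (hG : HasPropertyT G) (h1p : 1 < p) (hp : p ≠ ∞) :
    (RepFamily.allLp.{u, v} G p).HasSpectralGap := by
  obtain ⟨Q, ε, hQ, hε, hT'⟩ := hG
  have hT : IsPropertyTPair G Q ε := hT'
  have h2 : (2 : ℝ≥0∞) ≠ ∞ := ENNReal.ofNat_ne_top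
  obtain ⟨d₁, hd₁, H₁⟩ := exists_norm_mazur_sub_lt.{v} h2 hp 2 (show (0 : ℝ) < 1 / 2 by norm_num)
  set c := min (d₁ / 2) 1 with hc
  have hc0 : 0 < c := lt_min (by positivity) one_pos
  obtain ⟨d₂, hd₂, H₂⟩ := exists_norm_mazur_sub_lt.{v} hp h2 1 (mul_pos hε hc0)
  have hunit : ∀ (i : RepFamily.LpRep.{u, v} G p) (v : Lp ℂ p i.ν), v ∈ i.rep.compl → ‖v‖ = 1 →
      ∃ s ∈ Q, d₂ ≤ ‖v - i.rep s v‖ := by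
    intro i v hv hv1
    by_contra! hcon
    set w : Lp ℂ 2 i.ν := mazur hp h2 v with hw
    have hw1 : ‖w‖ = 1 := by
      have h := norm_mazur_rpow hp h2 v
      rw [hv1, Real.one_rpow, ← hw] at h
      exact (Real.rpow_left_inj (norm_nonneg _) zero_le_one (toReal_pos_of_fact h2).ne').1
        (by rw [h, Real.one_rpow])
    obtain ⟨x, hx, hwx⟩ := hT.exists_mem_fixed_norm_sub_le (i.rep.mazurConj hp) (w := w) hε hc0.le
      fun s hs => by
        rw [IsometricRep.mazurConj_apply, hw, mazur_mazur]
        refine H₂ i.X i.ν _ _ ?_ hv1.le ?_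
        · rw [LinearIsometryEquiv.norm_map, hv1]
        · rw [norm_sub_rev]
          exact hcon s hs
    have hx2 : ‖x‖ ≤ 2 := by
      have := norm_le_norm_add_norm_sub' x w
      rw [norm_sub_rev] at this
      have := min_le_right (d₁ / 2) 1
      linarith
    set u : Lp ℂ p i.ν := mazur h2 hp x with hu
    have hufix : u ∈ i.rep.fixed := fun g => by
      have := hx g
      rw [IsometricRep.mazurConj_apply] at this
      rw [hu, ← mazur_mazur hp h2 (i.rep g (mazur h2 hp x)), this]
    have hvu : ‖v - u‖ < 1 / 2 := by
      have := H₁ i.X i.ν w x (by rw [hw1]; norm_num) hx2 (by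
        have := min_le_left (d₁ / 2) 1
        linarith)
      rwa [hw, mazur_mazur] at this
    have h3 := i.rep.norm_le_norm_sub_of_mem_fixed h1p hp hufix hv
    have h4 := norm_le_norm_add_norm_sub' v u
    rw [norm_sub_rev] at h3
    linarith
  refine ⟨Q, d₂, hQ, hd₂, fun i v hv => ?_⟩
  change Lp ℂ p i.ν at v
  change d₂ * ‖v‖ ≤ ⨆ s : Q, ‖v - i.rep s v‖
  rcases eq_or_ne v 0 with rfl | hv0
  · simp
  have hn : 0 < ‖v‖ := norm_pos_iff.2 hv0
  have hcn : ‖((‖v‖⁻¹ : ℝ) : ℂ)‖ = ‖v‖⁻¹ := by simp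
  obtain ⟨s, hs, hsv⟩ := hunit i (((‖v‖⁻¹ : ℝ) : ℂ) • v) (i.rep.compl.smul_mem _ hv)
    (by rw [norm_smul, hcn, inv_mul_cancel₀ hn.ne'])
  rw [map_smul, ← smul_sub, norm_smul, hcn, inv_mul_eq_div, le_div_iff₀ hn] at hsv
  refine hsv.trans (le_ciSup (f := fun s : Q => ‖v - i.rep s v‖)
    ⟨2 * ‖v‖, Set.forall_mem_range.2 fun s => ?_⟩ ⟨s, hs⟩)
  have := norm_sub_le v (i.rep s v)
  rw [LinearIsometryEquiv.norm_map] at this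
  linarith

end LpGap

end

/-! ### Kazhdan projections, uniform convexity and property (T) -/

theorem theorem1p2 {G : Type u} [Group G] [TopologicalSpace G] [IsTopologicalGroup G]
    [LocallyCompactSpace G] [MeasurableSpace G] [BorelSpace G]
    (η : Measure G) [η.IsHaarMeasure] :
    -- families of isometric representations on a uniformly convex family of Banach spaces
    (∀ F : RepFamily.{u, v, w} G, F.IsUniformlyConvex → F.HasTrivialRep →
      ((∃ p : F.GroupAlg η, RepFamily.GroupAlg.IsKazhdanProjection p) ↔ F.HasSpectralGap) ∧
      ∀ p : F.GroupAlg η, RepFamily.GroupAlg.IsKazhdanProjection p →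
        RepFamily.GroupAlg.IsLimitOfConvPowers p) ∧
    -- all isometric representations on one uniformly convex Banach space
    (∀ (E : Type v) [NormedAddCommGroup E] [NormedSpace ℂ E] [CompleteSpace E]
      [UniformConvexSpace E],
      ((∃ p : (RepFamily.allOn G E).GroupAlg η, RepFamily.GroupAlg.IsKazhdanProjection p) ↔
        HasUniformTE G E) ∧
      ∀ p : (RepFamily.allOn G E).GroupAlg η, RepFamily.GroupAlg.IsKazhdanProjection p →
        RepFamily.GroupAlg.IsLimitOfConvPowers p) ∧
    -- property (T) and the `L_p`-maximal group algebras
    (HasPropertyT G → ∀ (p : ℝ≥0∞) [Fact (1 ≤ p)], 1 < p → p < ∞ →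
      ∃ q : (RepFamily.allLp.{u, v} G p).GroupAlg η,
        RepFamily.GroupAlg.IsKazhdanProjection q ∧
        RepFamily.GroupAlg.IsLimitOfConvPowers q) := by
  refine ⟨fun F hF htriv => ⟨⟨?_, ?_⟩, ?_⟩, fun E _ _ _ _ => ⟨⟨?_, ?_⟩, ?_⟩, ?_⟩
  · rintro ⟨p, hp⟩
    exact hp.hasSpectralGap htriv
  · intro hgap
    obtain ⟨p, hp, -⟩ := hgap.exists_isKazhdanProjection (η := η) hF
    exact ⟨p, hp⟩
  · intro p hp
    obtain ⟨q, hq, hlim⟩ := (hp.hasSpectralGap htriv).exists_isKazhdanProjection (η := η) hF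
    rwa [hp.unique hq]
  · rintro ⟨p, hp⟩
    exact hp.hasUniformTE
  · intro hgap
    obtain ⟨p, hp, -⟩ := RepFamily.HasSpectralGap.exists_isKazhdanProjection (η := η)
      RepFamily.isUniformlyConvex_allOn hgap
    exact ⟨p, hp⟩
  · intro p hp
    obtain ⟨q, hq, hlim⟩ := RepFamily.HasSpectralGap.exists_isKazhdanProjection (η := η)
      RepFamily.isUniformlyConvex_allOn hp.hasUniformTE
    rwa [hp.unique hq]
  · intro hG p _ h1p hp
    refine (hG.hasSpectralGap_allLp h1p hp.ne).exists_isKazhdanProjection fun t ht => ?_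
    obtain ⟨δ, hδ, h⟩ := exists_convexityModulusGE_Lp.{v} hp.ne h1p ht
    exact ⟨δ, hδ, fun i : RepFamily.LpRep.{u, v} G p => h i.X i.ν⟩
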